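/- Let $d\ge 0$ be an integer and let $\mathbf{F}_{2d}\to\mathbf{P}^1$ be the complex ruled surface that compactifies the line bundle $\mathcal{O}(2d)$ on $\mathbf{P}^1$ by a section at infinity $C_\infty$ (so $C_\infty^2=-2d$); let $F$ be a fibre. Let $\pi:X\to\mathbf{F}_{2d}$ be the Weierstrass model $y^2=x^3+a_2x^2+a_4x+a_6$, where $a_i$ is a binary form of degree $id$ on $\mathbf{P}^1$ and $x$ is the fibre coordinate of $\mathcal{O}(2d)$; that is, $X$ is the double cover of $\mathbf{F}_{2d}$ branched along $C_\infty\sqcup\mathcal{C}$, where $\mathcal{C}\subset\mathcal{O}(2d)$ is the trigonal curve $x^3+a_2x^2+a_4x+a_6=0$. Assume that $\mathcal{C}$ is smooth and irreducible (so that $d\geq 1$). Then $\mathcal{C}$ has genus $6d-2$. Moreover, let $\theta=(2d-1)F_{|\mathcal{C}}$ be the restriction to $\mathcal{C}$ of the divisor class $(2d-1)F$. Then $\theta$ is a theta characteristic on $\mathcal{C}$ (that is, $2\theta=K_{\mathcal{C}}$ in $\mathrm{Pic}(\mathcal{C})$), it is even (that is, $h^0(\mathcal{C},\theta)$ is even),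 and $$\dim H^0(\mathcal{C},\theta)=2d.$$ -/

import Mathlib

open MvPolynomial

noncomputable section

namespace Ruled

/-! ### The ruled surface `F_e`

`F_e` is the quotient of `(ℂ² ∖ 0) × (ℂ² ∖ 0)`, with homogeneous coordinates `(s, t, x, z)` indexed
by `0, 1, 2, 3`, by the torus `(l, m) • (s, t, x, z) = (l s, l t, lᵉ m x, m z)`. The projection to
the projective line is `(s : t)`; the open set `z ≠ 0` is the line bundle `O(e)` with fibre
coordinate `x / z`, and `z = 0` is the section at infinity. -/

/-- Homogeneous coordinate vectors of points of `F_e`. -/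
def Coord : Type :=
  {v : Fin 4 → ℂ // (v 0 ≠ 0 ∨ v 1 ≠ 0) ∧ (v 2 ≠ 0 ∨ v 3 ≠ 0)}

/-- The action of the torus on coordinate vectors. -/
def act (e : ℕ) (l m : ℂˣ) (v : Fin 4 → ℂ) : Fin 4 → ℂ :=
  ![l * v 0, l * v 1, (l : ℂ) ^ e * m * v 2, m * v 3]

lemma act_one (e : ℕ) (v : Fin 4 → ℂ) : act e 1 1 v = v := by
  funext i; fin_cases i <;> simp [act]

lemma act_act (e : ℕ) (l m l' m' : ℂˣ) (v : Fin 4 → ℂ) :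
    act e l m (act e l' m' v) = act e (l * l') (m * m') v := by
  funext i; fin_cases i <;> simp [act, mul_pow] <;> ring

/-- The action of the torus is free. -/
lemma act_free (e : ℕ) (l m : ℂˣ) (v : Coord) (h : v.1 = act e l m v.1) : l = 1 ∧ m = 1 := by
  have h0 := congrFun h 0
  have h1 := congrFun h 1
  have h2 := congrFun h 2
  have h3 := congrFun h 3
  simp only [act, Matrix.cons_val] at h0 h1 h2 h3
  have hl : (l : ℂ) = 1 := by
    rcases v.2.1 with h | h
    · exact mul_right_cancel₀ h (by rw [← h0, one_mul])
    · exact mul_right_cancel₀ h (by rw [← h1, one_mul])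
  have hm : (m : ℂ) = 1 := by
    rcases v.2.2 with h | h
    · refine mul_right_cancel₀ h ?_
      rw [hl, one_pow, one_mul] at h2
      rw [← h2, one_mul]
    · exact mul_right_cancel₀ h (by rw [← h3, one_mul])
  exact ⟨Units.ext hl, Units.ext hm⟩

/-- Two coordinate vectors define the same point of `F_e` iff they are in one torus orbit. -/
def coordSetoid (e : ℕ) : Setoid Coord where
  r v w := ∃ l m : ℂˣ, w.1 = act e l m v.1
  iseqv :=
    { refl := fun v => ⟨1, 1, (act_one e v.1).symm⟩
      symm := by
        rintro v w ⟨l, m, h⟩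
        exact ⟨l⁻¹, m⁻¹, by rw [h, act_act]; simp [act_one]⟩
      trans := by
        rintro u v w ⟨l, m, h⟩ ⟨l', m', h'⟩
        exact ⟨l' * l, m' * m, by rw [h', h, act_act]⟩ }

/-- The (closed points of the) ruled surface `F_e`. -/
def Surface (e : ℕ) : Type := Quotient (coordSetoid e)

/-- The point of `F_e` with given homogeneous coordinates. -/
def mk (e : ℕ) (v : Coord) : Surface e := Quotient.mk (coordSetoid e) v

lemma mk_eq_mk {e : ℕ} {v w : Coord} :
    mk e v = mk e w ↔ ∃ l m : ℂˣ, w.1 = act e l m v.1 :=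
  Quotient.eq (r := coordSetoid e)

/-- The bidegrees of the homogeneous coordinates `s, t, x, z`. A polynomial that is homogeneous of
bidegree `(a, b)` is a section of the line bundle of the divisor class `a F + b C_∞`. -/
def weight (e : ℕ) : Fin 4 → ℕ × ℕ := ![(1, 0), (1, 0), (e, 1), (0, 1)]

/-- The polynomial `A` is bihomogeneous of bidegree `n`. -/
abbrev IsBihom (e : ℕ) (A : MvPolynomial (Fin 4) ℂ) (n : ℕ × ℕ) : Prop :=
  IsWeightedHomogeneous (weight e) A n

/-- The points of `F_e` at which `A` vanishes (used for bihomogeneous `A`, for which the choice of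
the coordinate vector does not matter). -/
def zeroLocus (e : ℕ) (A : MvPolynomial (Fin 4) ℂ) : Set (Surface e) :=
  {p | ∃ v : Coord, mk e v = p ∧ eval v.1 A = 0}

/-- The section at infinity `C_∞`. -/
def sectionAtInfinity (e : ℕ) : Set (Surface e) := zeroLocus e (X 3)

/-- The linear form in `s, t` that vanishes at the point `c = (c 0 : c 1)` of the projective line;
its zero locus is the fibre of `F_e` over `c`. -/
def fibreForm (c : Fin 2 → ℂ) : MvPolynomial (Fin 4) ℂ := C (c 1) * X 0 - C (c 0) * X 1

lemma isBihom_X0 (e : ℕ) : IsBihom e (X 0) (1, 0) := isWeightedHomogeneous_X ℂ (weight e) 0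
lemma isBihom_X1 (e : ℕ) : IsBihom e (X 1) (1, 0) := isWeightedHomogeneous_X ℂ (weight e) 1

lemma isBihom_C (e : ℕ) (a : ℂ) : IsBihom e (C a) 0 := isWeightedHomogeneous_C (weight e) a

lemma isBihom_add {e : ℕ} {A B : MvPolynomial (Fin 4) ℂ} {n : ℕ × ℕ}
    (hA : IsBihom e A n) (hB : IsBihom e B n) : IsBihom e (A + B) n :=
  (weightedHomogeneousSubmodule ℂ (weight e) n).add_mem hA hB

lemma isBihom_fibreForm (e : ℕ) (c : Fin 2 → ℂ) : IsBihom e (fibreForm c) (1, 0) := by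
  have h1 := (isBihom_C e (c 1)).mul (isBihom_X0 e)
  have h0 := (isBihom_C e (c 0)).mul (isBihom_X1 e)
  rw [zero_add] at h0 h1
  exact (weightedHomogeneousSubmodule ℂ (weight e) (1, 0)).sub_mem h1 h0

end Ruled

open Ruled

/-- The data of a Weierstrass equation `y² = x³ + a₂ x² + a₄ x + a₆` over the projective line, with
`aᵢ` a binary form of degree `i d` (a global section of `O(i d)`). -/
structure WeierstrassModel (d : ℕ) where
  a₂ : MvPolynomial (Fin 2) ℂ
  a₄ : MvPolynomial (Fin 2) ℂ
  a₆ : MvPolynomial (Fin 2) ℂ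
  hom₂ : a₂.IsHomogeneous (2 * d)
  hom₄ : a₄.IsHomogeneous (4 * d)
  hom₆ : a₆.IsHomogeneous (6 * d)

namespace WeierstrassModel

variable {d : ℕ} (W : WeierstrassModel d)

/-- Binary forms in `s, t` as polynomials in `s, t, x, z`. -/
def lift (a : MvPolynomial (Fin 2) ℂ) : MvPolynomial (Fin 4) ℂ := rename ![0, 1] a

/-- The bihomogeneous form `x³ + a₂ x² z + a₄ x z² + a₆ z³` on `F_{2d}`. -/
def cubic : MvPolynomial (Fin 4) ℂ :=
  X 2 ^ 3 + lift W.a₂ * X 2 ^ 2 * X 3 + lift W.a₄ * X 2 * X 3 ^ 2 + lift W.a₆ * X 3 ^ 3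

lemma eval_lift (a : MvPolynomial (Fin 2) ℂ) (v : Fin 4 → ℂ) :
    eval v (lift a) = eval ![v 0, v 1] a := by
  rw [lift, eval_rename]
  congr 2
  funext i; fin_cases i <;> simp

lemma eval_cubic (v : Fin 4 → ℂ) : eval v W.cubic =
    v 2 ^ 3 + eval ![v 0, v 1] W.a₂ * v 2 ^ 2 * v 3 + eval ![v 0, v 1] W.a₄ * v 2 * v 3 ^ 2
      + eval ![v 0, v 1] W.a₆ * v 3 ^ 3 := by
  simp [cubic, eval_lift]

lemma eval_homog {a : MvPolynomial (Fin 2) ℂ} {n : ℕ} (ha : a.IsHomogeneous n) (l u v : ℂ) :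
    eval ![l * u, l * v] a = l ^ n * eval ![u, v] a := by
  rw [eval_eq, eval_eq, Finset.mul_sum]
  refine Finset.sum_congr rfl fun k hk => ?_
  have hdeg : k 0 + k 1 = n := by
    have h := ha (mem_support_iff.1 hk)
    rwa [Finsupp.weight_apply, Finsupp.sum_fintype _ _ (by simp), Fin.sum_univ_two,
      Pi.one_apply, Pi.one_apply, smul_eq_mul, smul_eq_mul, mul_one, mul_one] at h
  rw [Finset.prod_subset (Finset.subset_univ _), Finset.prod_subset (Finset.subset_univ k.support),
    Fin.prod_univ_two, Fin.prod_univ_two, ← hdeg]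
  · simp only [Matrix.cons_val]
    ring
  all_goals
    intro i _ hi
    rw [Finsupp.notMem_support_iff.1 hi, pow_zero]

lemma eval_cubic_act (l m : ℂˣ) (v : Fin 4 → ℂ) :
    eval (act (2 * d) l m v) W.cubic = (l : ℂ) ^ (6 * d) * (m : ℂ) ^ 3 * eval v W.cubic := by
  simp only [eval_cubic, act, Matrix.cons_val, eval_homog W.hom₂, eval_homog W.hom₄,
    eval_homog W.hom₆]
  ring

/-! ### The double cover -/

/-- Coordinates of the double cover `w² = z · cubic`, inside the line bundle of the class
`3d F + 2 C_∞` on `F_{2d}`. -/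
def CoverCoord : Type :=
  {q : Coord × ℂ // q.2 ^ 2 = q.1.1 3 * eval q.1.1 W.cubic}

/-- The torus acts on the coordinate `w` with weight `(3d, 2)`. -/
def coverSetoid : Setoid W.CoverCoord where
  r q q' := ∃ l m : ℂˣ, q'.1.1.1 = act (2 * d) l m q.1.1.1 ∧
    q'.1.2 = (l : ℂ) ^ (3 * d) * (m : ℂ) ^ 2 * q.1.2
  iseqv :=
    { refl := fun q => ⟨1, 1, (act_one _ _).symm, by simp⟩
      symm := by
        rintro q q' ⟨l, m, h, h'⟩
        refine ⟨l⁻¹, m⁻¹, by rw [h, act_act]; simp [act_one], ?_⟩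
        rw [h']
        have hl : (l : ℂ) ≠ 0 := l.ne_zero
        have hm : (m : ℂ) ≠ 0 := m.ne_zero
        simp only [Units.val_inv_eq_inv_val, inv_pow]
        field_simp
      trans := by
        rintro q q' q'' ⟨l, m, h, k⟩ ⟨l', m', h', k'⟩
        refine ⟨l' * l, m' * m, by rw [h', h, act_act], ?_⟩
        rw [k', k]
        push_cast
        ring }

/-- The Weierstrass model `X`: the double cover of `F_{2d}` with equation `w² = z · cubic`; where
`z = 1` this is the Weierstrass equation `w² = x³ + a₂ x² + a₄ x + a₆`. -/
def Cover : Type := Quotient W.coverSetoid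

/-- The covering map `π : X → F_{2d}`. -/
def coverMap : W.Cover → Surface (2 * d) :=
  Quotient.lift (s := W.coverSetoid) (fun q => Ruled.mk (2 * d) q.1.1) (by
    rintro q q' ⟨l, m, h, -⟩
    exact mk_eq_mk.2 ⟨l, m, h⟩)

/-- The branch locus of `π`: the points over which there is only one point. -/
def branchLocus : Set (Surface (2 * d)) := {p | ∃! q : W.Cover, W.coverMap q = p}

/-- The branch curve `𝒞`: the branch locus of `π` without the section at infinity. -/
def branchCurve : Set (Surface (2 * d)) := W.branchLocus \ sectionAtInfinity (2 * d)

lemma mk_mem_branchLocus (v : Coord) :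
    Ruled.mk (2 * d) v ∈ W.branchLocus ↔ v.1 3 * eval v.1 W.cubic = 0 := by
  constructor
  · rintro ⟨q, -, huniq⟩
    obtain ⟨w, hw⟩ := IsAlgClosed.exists_pow_nat_eq (v.1 3 * eval v.1 W.cubic) (n := 2) (by norm_num)
    let q₁ : W.CoverCoord := ⟨(v, w), hw⟩
    let q₂ : W.CoverCoord := ⟨(v, -w), by simpa using hw⟩
    have h₁ := huniq (Quotient.mk W.coverSetoid q₁) rfl
    have h₂ := huniq (Quotient.mk W.coverSetoid q₂) rfl
    obtain ⟨l, m, h, h'⟩ := (Quotient.eq (r := W.coverSetoid)).1 (h₁.trans h₂.symm)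
    obtain ⟨rfl, rfl⟩ := act_free _ l m v h
    have h0 : -w = w := by simpa [q₁, q₂] using h'
    have : w = 0 := by linear_combination (-1 / 2 : ℂ) * h0
    rw [← hw, this]; simp
  · intro h
    refine ⟨Quotient.mk W.coverSetoid ⟨(v, 0), by simp [h]⟩, rfl, ?_⟩
    intro q
    refine Quotient.inductionOn q (fun q hq => ?_)
    obtain ⟨⟨v', w⟩, hw⟩ := q
    obtain ⟨l, m, h'⟩ := mk_eq_mk.1 (show Ruled.mk (2 * d) v' = Ruled.mk (2 * d) v from hq)
    have hw0 : w = 0 := by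
      have e3 : v.1 3 = m * v'.1 3 := by rw [h']; simp [act]
      rw [h', eval_cubic_act, ← h', e3] at h
      have hl : (l : ℂ) ≠ 0 := l.ne_zero
      have hm : (m : ℂ) ≠ 0 := m.ne_zero
      have h2 : w ^ 2 = v'.1 3 * eval v'.1 W.cubic := hw
      have h3 : v'.1 3 * eval v'.1 W.cubic = 0 := by
        have : ((m : ℂ) * ((l : ℂ) ^ (6 * d) * (m : ℂ) ^ 3)) * (v'.1 3 * eval v'.1 W.cubic) = 0 := by
          linear_combination h
        exact (mul_eq_zero.1 this).resolve_left (by positivity)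
      rw [h3] at h2
      exact pow_eq_zero_iff (by norm_num) |>.1 h2
    refine Quotient.sound (s := W.coverSetoid) ⟨l, m, h', ?_⟩
    simp [hw0]

lemma mk_mem_sectionAtInfinity (e : ℕ) (v : Coord) :
    Ruled.mk e v ∈ sectionAtInfinity e ↔ v.1 3 = 0 := by
  constructor
  · rintro ⟨w, hw, h0⟩
    obtain ⟨l, m, h⟩ := mk_eq_mk.1 hw
    rw [eval_X] at h0
    rw [h]
    simp [act, h0]
  · intro h
    exact ⟨v, rfl, by rw [eval_X, h]⟩

/-- `𝒞` is the curve with equation `cubic = 0`. -/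
lemma mk_mem_branchCurve (v : Coord) :
    Ruled.mk (2 * d) v ∈ W.branchCurve ↔ eval v.1 W.cubic = 0 := by
  rw [branchCurve, Set.mem_sdiff, mk_mem_branchLocus, mk_mem_sectionAtInfinity]
  constructor
  · rintro ⟨h, h3⟩
    exact (mul_eq_zero.1 h).resolve_left h3
  · intro h
    refine ⟨by rw [h, mul_zero], fun h3 => ?_⟩
    rw [eval_cubic, h3] at h
    have h2 : v.1 2 = 0 := by simpa using h
    exact v.2.2.elim (fun k => k h2) (fun k => k h3)

/-- A fibre of `F_{2d}` meets `𝒞` in finitely many points. -/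
lemma finite_fibre (c : Fin 2 → ℂ) (hc : c ≠ 0) :
    (W.branchCurve ∩ zeroLocus (2 * d) (fibreForm c)).Finite := by
  have hc' : c 0 ≠ 0 ∨ c 1 ≠ 0 := by
    by_contra! h
    exact hc (funext fun i => by fin_cases i <;> simp [h])
  let Q : Polynomial ℂ := Polynomial.X ^ 3 + (Polynomial.C (eval ![c 0, c 1] W.a₂) *
    Polynomial.X ^ 2 + Polynomial.C (eval ![c 0, c 1] W.a₄) * Polynomial.X +
    Polynomial.C (eval ![c 0, c 1] W.a₆))
  have hQ : Q ≠ 0 :=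
    (Polynomial.monic_X_pow_add (n := 3) (by compute_degree!)).ne_zero
  let pt : ℂ → Surface (2 * d) := fun x =>
    Ruled.mk (2 * d) ⟨![c 0, c 1, x, 1], by simpa using hc'⟩
  refine ((Q.rootSet_finite ℂ).image pt).subset ?_
  rintro p ⟨hp, v, rfl, hv⟩
  have hG := (W.mk_mem_branchCurve v).1 hp
  have h3 : v.1 3 ≠ 0 := by
    intro h3
    rw [eval_cubic, h3] at hG
    have h2 : v.1 2 = 0 := by simpa using hG
    exact v.2.2.elim (fun k => k h2) (fun k => k h3)
  have hv' : c 1 * v.1 0 = c 0 * v.1 1 := by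
    simpa [fibreForm, sub_eq_zero] using hv
  obtain ⟨l, hl0, hl1⟩ : ∃ l : ℂˣ, c 0 = l * v.1 0 ∧ c 1 = l * v.1 1 := by
    by_cases h0 : v.1 0 = 0
    · have h1 : v.1 1 ≠ 0 := v.2.1.resolve_left (not_not.2 h0)
      have hc0 : c 0 = 0 := by
        rw [h0, mul_zero] at hv'
        exact (mul_eq_zero.1 hv'.symm).resolve_right h1
      have hc1 : c 1 ≠ 0 := hc'.resolve_left (not_not.2 hc0)
      exact ⟨Units.mk0 (c 1 / v.1 1) (div_ne_zero hc1 h1), by simp [hc0, h0], by simp [h1]⟩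
    · have hc0 : c 0 ≠ 0 := by
        intro k
        rw [k, zero_mul] at hv'
        exact hc'.elim (fun k' => k' k) (fun k' => k' ((mul_eq_zero.1 hv').resolve_right h0))
      refine ⟨Units.mk0 (c 0 / v.1 0) (div_ne_zero hc0 h0), by simp [h0], ?_⟩
      simp only [Units.val_mk0]
      field_simp
      linear_combination hv'
  let m : ℂˣ := Units.mk0 (v.1 3)⁻¹ (inv_ne_zero h3)
  have hw : ![c 0, c 1, (l : ℂ) ^ (2 * d) * m * v.1 2, 1] = act (2 * d) l m v.1 := by
    funext i
    fin_cases i <;> simp [act, hl0, hl1, m, h3]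
  refine ⟨(l : ℂ) ^ (2 * d) * m * v.1 2, ?_, (mk_eq_mk.2 ⟨l, m, hw⟩).symm⟩
  rw [Polynomial.mem_rootSet]
  refine ⟨hQ, ?_⟩
  have hE := W.eval_cubic_act l m v.1
  rw [hG, mul_zero, ← hw, eval_cubic] at hE
  simp only [Matrix.cons_val] at hE
  simp only [Q, map_add, map_mul, map_pow, Polynomial.aeval_X, Polynomial.aeval_C,
    Algebra.algebraMap_self, RingHom.id_apply]
  linear_combination hE

/-- `𝒞` is smooth: the differential of its equation vanishes at no point of `𝒞`. -/
def IsSmooth : Prop :=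
  ∀ v : Coord, Ruled.mk (2 * d) v ∈ W.branchCurve → ∃ i, eval v.1 (pderiv i W.cubic) ≠ 0

/-- `𝒞` is irreducible (as a divisor): its equation is an irreducible polynomial. -/
class IsIrreducible : Prop where
  irreducible : Irreducible W.cubic

/-! ### Rational functions on `𝒞` -/

/-- The bigraded homogeneous coordinate ring of `𝒞`. -/
abbrev CoordRing : Type := MvPolynomial (Fin 4) ℂ ⧸ Ideal.span {W.cubic}

variable [W.IsIrreducible]

instance : IsDomain W.CoordRing := by
  have hp : Prime W.cubic := (IsIrreducible.irreducible (W := W)).prime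
  have : (Ideal.span {W.cubic}).IsPrime := (Ideal.span_singleton_prime hp.ne_zero).2 hp
  exact Ideal.Quotient.isDomain _

/-- The class of a polynomial in the fraction field of the homogeneous coordinate ring. -/
def res : MvPolynomial (Fin 4) ℂ →ₐ[ℂ] FractionRing W.CoordRing :=
  (IsScalarTower.toAlgHom ℂ W.CoordRing (FractionRing W.CoordRing)).comp
    (Ideal.Quotient.mkₐ ℂ (Ideal.span {W.cubic}))

lemma res_eq_zero_iff (A : MvPolynomial (Fin 4) ℂ) : W.res A = 0 ↔ W.cubic ∣ A := by
  have : W.res A = algebraMap W.CoordRing (FractionRing W.CoordRing)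
      (Ideal.Quotient.mk (Ideal.span {W.cubic}) A) := rfl
  rw [this, IsFractionRing.to_map_eq_zero_iff, Ideal.Quotient.eq_zero_iff_mem,
    Ideal.mem_span_singleton]

/-- The field of rational functions on `𝒞`: quotients of bihomogeneous polynomials of equal
bidegree, restricted to `𝒞`. -/
def functionField : IntermediateField ℂ (FractionRing W.CoordRing) where
  carrier := {f | ∃ (n : ℕ × ℕ) (A B : MvPolynomial (Fin 4) ℂ), IsBihom (2 * d) A n ∧
    IsBihom (2 * d) B n ∧ W.res B ≠ 0 ∧ f = W.res A / W.res B}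
  mul_mem' := by
    rintro f g ⟨n, A, B, hA, hB, h0, rfl⟩ ⟨n', A', B', hA', hB', h0', rfl⟩
    exact ⟨n + n', A * A', B * B', hA.mul hA', hB.mul hB', by simp [h0, h0'],
      by rw [map_mul, map_mul, div_mul_div_comm]⟩
  add_mem' := by
    rintro f g ⟨n, A, B, hA, hB, h0, rfl⟩ ⟨n', A', B', hA', hB', h0', rfl⟩
    exact ⟨n + n', A * B' + B * A', B * B', isBihom_add (hA.mul hB') (hB.mul hA'), hB.mul hB',
      by simp [h0, h0'], by rw [map_add, map_mul, map_mul, map_mul, div_add_div _ _ h0 h0']⟩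
  algebraMap_mem' := fun a =>
    ⟨0, C a, 1, isBihom_C _ a, isWeightedHomogeneous_one _ _, by simp, by
      rw [map_one, div_one]; exact (W.res.commutes a).symm⟩
  inv_mem' := by
    rintro f ⟨n, A, B, hA, hB, h0, rfl⟩
    by_cases hA0 : W.res A = 0
    · exact ⟨0, 0, 1, isWeightedHomogeneous_zero _ _ _, isWeightedHomogeneous_one _ _, by simp,
        by simp [hA0]⟩
    · exact ⟨n, B, A, hB, hA, hA0, by rw [inv_div]⟩

/-- The rational function `A / B` on `𝒞`. -/
def ratio (A B : MvPolynomial (Fin 4) ℂ) (n : ℕ × ℕ) (hA : IsBihom (2 * d) A n)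
    (hB : IsBihom (2 * d) B n) : W.functionField :=
  ⟨W.res A / W.res B, by
    by_cases h : W.res B = 0
    · rw [h, div_zero]; exact zero_mem _
    · exact ⟨n, A, B, hA, hB, h, rfl⟩⟩

/-- The local ring of `𝒞` at `p`: the rational functions `A / B` whose denominator does not vanish
at `p`. -/
def localRing (p : Surface (2 * d)) : Subalgebra ℂ W.functionField where
  carrier := {f | ∃ (n : ℕ × ℕ) (A B : MvPolynomial (Fin 4) ℂ), IsBihom (2 * d) A n ∧
    IsBihom (2 * d) B n ∧ W.res B ≠ 0 ∧ p ∉ zeroLocus (2 * d) B ∧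
    (f : FractionRing W.CoordRing) = W.res A / W.res B}
  mul_mem' := by
    rintro f g ⟨n, A, B, hA, hB, h0, hp, hf⟩ ⟨n', A', B', hA', hB', h0', hp', hg⟩
    refine ⟨n + n', A * A', B * B', hA.mul hA', hB.mul hB', by simp [h0, h0'], ?_,
      by push_cast; rw [hf, hg, map_mul, map_mul, div_mul_div_comm]⟩
    rintro ⟨v, hv, h⟩
    rw [map_mul] at h
    exact (mul_eq_zero.1 h).elim (fun k => hp ⟨v, hv, k⟩) (fun k => hp' ⟨v, hv, k⟩)
  add_mem' := by
    rintro f g ⟨n, A, B, hA, hB, h0, hp, hf⟩ ⟨n', A', B', hA', hB', h0', hp', hg⟩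
    refine ⟨n + n', A * B' + B * A', B * B', isBihom_add (hA.mul hB') (hB.mul hA'), hB.mul hB',
      by simp [h0, h0'], ?_, by
        push_cast; rw [hf, hg, map_add, map_mul, map_mul, map_mul, div_add_div _ _ h0 h0']⟩
    rintro ⟨v, hv, h⟩
    rw [map_mul] at h
    exact (mul_eq_zero.1 h).elim (fun k => hp ⟨v, hv, k⟩) (fun k => hp' ⟨v, hv, k⟩)
  algebraMap_mem' := fun a =>
    ⟨0, C a, 1, isBihom_C _ a, isWeightedHomogeneous_one _ _, by simp,
      by rintro ⟨v, -, h⟩; simp at h, by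
      rw [map_one, div_one]; exact (W.res.commutes a).symm⟩

/-! ### Orders, divisors, differentials -/

/-- `π` is a local parameter at `p`: its multiples are exactly the non-units of the local ring. -/
def IsUniformizer (p : Surface (2 * d)) (π : W.localRing p) : Prop :=
  ∀ f : W.localRing p, π ∣ f ↔ ¬ IsUnit f

/-- `f` has order `n` at `p`: it is a unit of the local ring times the `n`-th power of a local
parameter. -/
def HasOrd (p : Surface (2 * d)) (f : W.functionField) (n : ℤ) : Prop :=
  ∃ (π : W.localRing p) (u : (W.localRing p)ˣ), W.IsUniformizer p π ∧
    f = ((u : W.localRing p) : W.functionField) * (π : W.functionField) ^ n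

open Classical in
/-- The order of vanishing of `f` at `p`; the value `0` is used if `f` has no order (for smooth `𝒞`
only if `f = 0`). -/
def ord (p : Surface (2 * d)) (f : W.functionField) : ℤ :=
  if h : ∃ n, W.HasOrd p f n then h.choose else 0

lemma ord_unit (p : Surface (2 * d)) (u : (W.localRing p)ˣ) :
    W.ord p ((u : W.localRing p) : W.functionField) = 0 := by
  unfold ord
  split_ifs with h
  · generalize hn : h.choose = n
    have hs : W.HasOrd p ((u : W.localRing p) : W.functionField) n := hn ▸ h.choose_spec
    obtain ⟨π, u', hπ, he⟩ := hs
    have hπu : ¬ IsUnit π := (hπ π).1 dvd_rfl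
    have key : ∀ (k : ℕ) (a b : (W.localRing p)ˣ), k ≠ 0 →
        (a : W.localRing p) = (b : W.localRing p) * π ^ k → False := by
      intro k a b hk hab
      have h1 : IsUnit ((b : W.localRing p) * π ^ k) := hab ▸ a.isUnit
      exact hπu ((isUnit_pow_iff hk).1 (isUnit_of_mul_isUnit_right h1))
    rcases Int.eq_nat_or_neg n with ⟨k, rfl | rfl⟩
    · by_contra hk
      refine key k u u' (by rintro rfl; exact hk rfl) ?_
      apply Subtype.ext
      rw [he]; push_cast; rw [zpow_natCast]
    · by_contra hk
      refine key k u' u (by rintro rfl; exact hk rfl) ?_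
      have hu : ((u : W.localRing p) : W.functionField) ≠ 0 := by
        intro h0
        exact u.ne_zero (Subtype.ext h0)
      have hπ0 : (π : W.functionField) ≠ 0 := by
        intro h0
        rw [h0, zero_zpow _ hk, mul_zero] at he
        exact hu he
      apply Subtype.ext
      push_cast
      rw [he, zpow_neg, zpow_natCast, mul_assoc, inv_mul_cancel₀ (pow_ne_zero _ hπ0), mul_one]
  · rfl

/-- Divisors on `𝒞`. -/
abbrev Divisor : Type := W.branchCurve →₀ ℤ

/-- Linear equivalence: the difference of the two divisors is the divisor of a rational function. -/
def LinEquiv (D D' : W.Divisor) : Prop :=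
  ∃ f : W.functionField, f ≠ 0 ∧ ∀ p : W.branchCurve, W.HasOrd p f (D p - D' p)

/-- The space `H⁰(𝒞, O(D))` of global sections. Near `p` the sheaf `O(D)` is generated by `g⁻¹`,
for any local equation `g` of `D` at `p`. -/
def H0 (D : W.Divisor) : Submodule ℂ W.functionField where
  carrier := {f | ∀ (p : W.branchCurve) (g : W.functionField), W.HasOrd p g (D p) →
    f * g ∈ W.localRing p}
  add_mem' := fun hf hg p k hk => by rw [add_mul]; exact add_mem (hf p k hk) (hg p k hk)
  zero_mem' := fun p k _ => by rw [zero_mul]; exact zero_mem _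
  smul_mem' := fun a f hf p k hk => by
    rw [smul_mul_assoc]; exact Subalgebra.smul_mem _ (hf p k hk) a

/-- The dimension `h⁰(𝒞, D)`. -/
def h0 (D : W.Divisor) : ℕ := Module.finrank ℂ (W.H0 D)

/-- `D` is a canonical divisor: the divisor of a nonzero rational differential form `ω`, where
the order of `f dπ` at `p` is that of `f` if `π` is a local parameter. -/
def IsCanonical (D : W.Divisor) : Prop :=
  ∃ ω : Ω[W.functionField⁄ℂ], ω ≠ 0 ∧ ∀ p : W.branchCurve,
    ∃ (π : W.localRing p) (f : W.functionField), W.IsUniformizer p π ∧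
      ω = f • KaehlerDifferential.D ℂ W.functionField π ∧ W.HasOrd p f (D p)

/-- The space of regular differential forms on `𝒞`. -/
def regularForms : Submodule ℂ Ω[W.functionField⁄ℂ] where
  carrier := {ω | ∀ (p : W.branchCurve) (π : W.localRing p), W.IsUniformizer p π →
    ∃ f : W.localRing p, ω = (f : W.functionField) • KaehlerDifferential.D ℂ W.functionField π}
  add_mem' := fun ha hb p π hπ => by
    obtain ⟨f, rfl⟩ := ha p π hπ
    obtain ⟨g, hg⟩ := hb p π hπ
    exact ⟨f + g, by rw [hg, ← add_smul]; rfl⟩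
  zero_mem' := fun p π _ => ⟨0, by simp⟩
  smul_mem' := fun a ω h p π hπ => by
    obtain ⟨f, rfl⟩ := h p π hπ
    exact ⟨a • f, by rw [Subalgebra.coe_smul, smul_assoc]⟩

/-- The genus of `𝒞`. -/
def genus : ℕ := Module.finrank ℂ W.regularForms

/-- A theta characteristic is (the class of) a divisor `D` such that `2 D` is linearly equivalent to
a canonical divisor. -/
def IsThetaCharacteristic (D : W.Divisor) : Prop :=
  ∃ K : W.Divisor, W.IsCanonical K ∧ W.LinEquiv ((2 : ℤ) • D) K

/-! ### The restriction of a fibre to `𝒞` -/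

open Classical in
/-- A linear form in `s, t` that does not vanish at `p`. -/
def denom (p : Surface (2 * d)) : MvPolynomial (Fin 4) ℂ :=
  if p ∈ zeroLocus (2 * d) (X 0) then X 1 else X 0

lemma isBihom_denom (p : Surface (2 * d)) : IsBihom (2 * d) (denom p) (1, 0) := by
  unfold denom
  split_ifs
  · exact isBihom_X1 _
  · exact isBihom_X0 _

lemma notMem_zeroLocus_denom (p : Surface (2 * d)) : p ∉ zeroLocus (2 * d) (denom p) := by
  unfold denom
  split_ifs with h
  · obtain ⟨v, rfl, hv⟩ := h
    rintro ⟨w, hw, hw1⟩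
    obtain ⟨l, m, h⟩ := mk_eq_mk.1 hw
    rw [eval_X] at hv hw1
    refine v.2.1.elim (fun k => k hv) (fun k => k ?_)
    rw [h]
    simp [act, hw1]
  · exact h

/-- The local equation at `p` of the fibre of `F_{2d}` over `c`, restricted to `𝒞`. -/
def fibreEquation (c : Fin 2 → ℂ) (p : Surface (2 * d)) : W.functionField :=
  W.ratio (fibreForm c) (denom p) (1, 0) (isBihom_fibreForm _ c) (isBihom_denom p)

lemma res_ne_zero {A : MvPolynomial (Fin 4) ℂ} {p : Surface (2 * d)} (hp : p ∈ W.branchCurve)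
    (h : p ∉ zeroLocus (2 * d) A) : W.res A ≠ 0 := by
  intro h0
  obtain ⟨B, rfl⟩ := (W.res_eq_zero_iff A).1 h0
  obtain ⟨v, rfl⟩ : ∃ v, Ruled.mk (2 * d) v = p := Quotient.exists_rep p
  refine h ⟨v, rfl, ?_⟩
  rw [map_mul, (W.mk_mem_branchCurve v).1 hp, zero_mul]

lemma ord_fibreEquation_eq_zero (c : Fin 2 → ℂ) (p : Surface (2 * d)) (hp : p ∈ W.branchCurve)
    (h : p ∉ zeroLocus (2 * d) (fibreForm c)) : W.ord p (W.fibreEquation c p) = 0 := by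
  have hA := W.res_ne_zero hp h
  have hB := W.res_ne_zero hp (notMem_zeroLocus_denom p)
  let f : W.localRing p := ⟨W.fibreEquation c p, (1, 0), fibreForm c, denom p,
    isBihom_fibreForm _ c, isBihom_denom p, hB, notMem_zeroLocus_denom p, rfl⟩
  let g : W.localRing p := ⟨W.ratio (denom p) (fibreForm c) (1, 0) (isBihom_denom p)
    (isBihom_fibreForm _ c), (1, 0), denom p, fibreForm c,
    isBihom_denom p, isBihom_fibreForm _ c, hA, h, rfl⟩
  have hfg : f * g = 1 := by
    apply Subtype.ext
    apply Subtype.ext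
    change W.res (fibreForm c) / W.res (denom p) * (W.res (denom p) / W.res (fibreForm c)) = 1
    field_simp
  exact W.ord_unit p ⟨f, g, hfg, by rw [mul_comm, hfg]⟩

/-- The restriction `F|_𝒞` to `𝒞` of the fibre `F` of `F_{2d}` over the point `c` of the projective
line: its multiplicity at `p` is the order at `p` of the local equation of `F`. -/
def fibreDivisor (c : Fin 2 → ℂ) (hc : c ≠ 0) : W.Divisor :=
  Finsupp.ofSupportFinite (fun p => W.ord p (W.fibreEquation c p)) (by
    refine Set.Finite.of_finite_image (f := Subtype.val) ((W.finite_fibre c hc).subset ?_)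
      Subtype.val_injective.injOn
    rintro _ ⟨p, hp, rfl⟩
    refine ⟨p.2, ?_⟩
    by_contra h
    exact hp (W.ord_fibreEquation_eq_zero c p p.2 h))

end WeierstrassModel

end

/-! Two computations carry the proof, and smoothness lets both be done point by point.

Sections of multiples of a fibre. The equation of `𝒞` is monic of degree 3 in `x`, and `x` has
weight `2d`, so the direct image of the structure sheaf on the projective line is `O ⊕ O(-2d) ⊕
O(-4d)`, with basis `1, x, x²`. Hence `h⁰(kF|_𝒞)` is `(k+1) + (k+1-2d) + (k+1-4d)`, negative terms
counting as 0. This is `finrank_fibreSections`; its core is the comparison of the two affine charts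
in `natDegree_coeff_add_le_of_mem`.

Adjunction. If `u` is the base coordinate and `G` the affine equation, the residue form `du / ∂ₓG`
generates the regular differentials on its chart (`IsSmooth.D_uniformizer`). From one chart to the
other it changes by the power `4d - 2` of the transition function, up to sign
(`residueForm_zero_eq`): `∂ₓG` contributes `4d` and `du` contributes `-2`. So the canonical class is
`(4d-2)F|_𝒞`, which is twice `θ`.

The genus is the case `k = 4d - 2`, namely `(4d-1) + (2d-1) + 0`. For `k = 2d - 1` only the first
summand survives and gives `2d`, which is even. `IsSmooth.mem_H0_iff` and `IsSmooth.genus_eq`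
translate the intrinsic definitions of `h⁰` and of the genus into these spaces. -/

noncomputable section

open Ruled

/-! ### Affine charts of the ruled surface and dehomogenization -/

namespace Ruled

/-- The index of the base coordinate which is nonzero on the `i`-th chart. -/
def baseIdx (i : Fin 2) : Fin 4 := ![0, 1] i

/-- The index of the other base coordinate. -/
def paramIdx (i : Fin 2) : Fin 4 := ![1, 0] i

/-- The coordinate vector of the point of the `i`-th chart with affine coordinates `a, b`. -/
def chartVec {R : Type*} [CommSemiring R] (i : Fin 2) (a b : R) : Fin 4 → R :=
  ![![1, a, b, 1], ![a, 1, b, 1]] i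

/-- Dehomogenization on the `i`-th chart. -/
def dehom (i : Fin 2) : MvPolynomial (Fin 4) ℂ →ₐ[ℂ] MvPolynomial (Fin 2) ℂ :=
  aeval (chartVec i (X 0) (X 1))

lemma dehom_X_baseIdx (i : Fin 2) : dehom i (X (baseIdx i)) = 1 := by
  fin_cases i <;> simp [dehom, baseIdx, chartVec]

lemma dehom_X_paramIdx (i : Fin 2) : dehom i (X (paramIdx i)) = X 0 := by
  fin_cases i <;> simp [dehom, paramIdx, chartVec]

lemma dehom_X2 (i : Fin 2) : dehom i (X 2) = X 1 := by
  fin_cases i <;> simp [dehom, chartVec]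

lemma dehom_X3 (i : Fin 2) : dehom i (X 3) = 1 := by
  fin_cases i <;> simp [dehom, chartVec]

lemma aeval_dehom {R : Type*} [CommRing R] [Algebra ℂ R] (i : Fin 2) (w : Fin 2 → R)
    (A : MvPolynomial (Fin 4) ℂ) : aeval w (dehom i A) = aeval (chartVec i (w 0) (w 1)) A := by
  rw [dehom, ← AlgHom.comp_apply, comp_aeval]
  congr 2
  funext j
  fin_cases i <;> fin_cases j <;> simp [chartVec]

lemma isBihom_X_baseIdx (e : ℕ) (i : Fin 2) : IsBihom e (X (baseIdx i)) (1, 0) := by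
  fin_cases i
  exacts [isBihom_X0 e, isBihom_X1 e]

lemma isBihom_X_paramIdx (e : ℕ) (i : Fin 2) : IsBihom e (X (paramIdx i)) (1, 0) := by
  fin_cases i
  exacts [isBihom_X1 e, isBihom_X0 e]

lemma isBihom_X2 (e : ℕ) : IsBihom e (X 2) (e, 1) := isWeightedHomogeneous_X ℂ (weight e) 2
lemma isBihom_X3 (e : ℕ) : IsBihom e (X 3) (0, 1) := isWeightedHomogeneous_X ℂ (weight e) 3

lemma isBihom_baseIdx_pow_mul_X3_pow (e : ℕ) (i : Fin 2) (k : ℕ × ℕ) :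
    IsBihom e (X (baseIdx i) ^ k.1 * X 3 ^ k.2) k := by
  simpa using ((isBihom_X_baseIdx e i).pow k.1).mul ((isBihom_X3 e).pow k.2)

lemma weight_apply_fin4 (e : ℕ) (k : Fin 4 →₀ ℕ) :
    Finsupp.weight (weight e) k = (k 0 + k 1 + k 2 * e, k 2 + k 3) := by
  rw [Finsupp.weight_apply, Finsupp.sum_fintype _ _ (by simp), Fin.sum_univ_four]
  simp [weight]

/-- The value of a bihomogeneous polynomial in terms of its dehomogenization. -/
lemma map_eq_aeval_dehom {F : Type*} [Field F] [Algebra ℂ F] {e : ℕ}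
    (φ : MvPolynomial (Fin 4) ℂ →ₐ[ℂ] F) (i : Fin 2) {A : MvPolynomial (Fin 4) ℂ} {n : ℕ × ℕ}
    (hA : IsBihom e A n) (hs : φ (X (baseIdx i)) ≠ 0) (hz : φ (X 3) ≠ 0) :
    φ A = φ (X (baseIdx i)) ^ n.1 * φ (X 3) ^ n.2 *
      aeval ![φ (X (paramIdx i)) / φ (X (baseIdx i)),
        φ (X 2) / (φ (X (baseIdx i)) ^ e * φ (X 3))] (dehom i A) := by
  induction hA using IsWeightedHomogeneous.induction_on with
  | zero => simp
  | add p q hp hq h1 h2 => rw [map_add, h1, h2, map_add, map_add, mul_add]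
  | monomial k r hk =>
    -- The bidegree of the monomial is `(k₀ + k₁ + e k₂, k₂ + k₃)`, so the prefactors cancel exactly
    -- the denominators of the affine coordinates.
    rw [weight_apply_fin4] at hk
    obtain rfl := hk
    have hφ : φ = aeval (fun j => φ (X j)) := by ext; simp
    rw [aeval_dehom]
    conv_lhs => rw [hφ]
    simp only [aeval_monomial, Finsupp.prod_fintype _ _ (fun _ => pow_zero _), Fin.prod_univ_four]
    fin_cases i <;> simp [chartVec, baseIdx, paramIdx] at hs ⊢ <;>
      rw [pow_add, pow_add, pow_add, mul_comm (k 2) e, pow_mul, div_pow, div_pow, mul_pow] <;>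
      field_simp

lemma eval_act_of_isBihom {e : ℕ} {A : MvPolynomial (Fin 4) ℂ} {n : ℕ × ℕ} (hA : IsBihom e A n)
    (l m : ℂˣ) (v : Fin 4 → ℂ) :
    eval (act e l m v) A = (l : ℂ) ^ n.1 * (m : ℂ) ^ n.2 * eval v A := by
  induction hA using IsWeightedHomogeneous.induction_on with
  | zero => simp
  | add p q hp hq h1 h2 => rw [map_add, h1, h2, map_add, mul_add]
  | monomial k r hk =>
    rw [weight_apply_fin4] at hk
    obtain rfl := hk
    simp only [eval_monomial, Finsupp.prod_fintype _ _ (fun _ => pow_zero _), Fin.prod_univ_four]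
    simp [act]
    ring

/-- `zeroLocus` only asks for some representative at which `A` vanishes. The torus rescales the
value of a bihomogeneous form, so every representative decides. -/
lemma mk_mem_zeroLocus_iff {e : ℕ} {A : MvPolynomial (Fin 4) ℂ} {n : ℕ × ℕ} (hA : IsBihom e A n)
    (v : Coord) : Ruled.mk e v ∈ zeroLocus e A ↔ eval v.1 A = 0 := by
  refine ⟨?_, fun h => ⟨v, rfl, h⟩⟩
  rintro ⟨w, hw, h0⟩
  obtain ⟨l, m, h⟩ := mk_eq_mk.1 hw
  rw [h, eval_act_of_isBihom hA, h0, mul_zero]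

/-- Every polynomial in the affine coordinates is the dehomogenization of a bihomogeneous one. -/
lemma exists_isBihom_dehom_eq (e : ℕ) (i : Fin 2) (P : MvPolynomial (Fin 2) ℂ) :
    ∃ (n : ℕ × ℕ) (A : MvPolynomial (Fin 4) ℂ), IsBihom e A n ∧ dehom i A = P := by
  induction P using MvPolynomial.induction_on with
  | C a => exact ⟨0, C a, isBihom_C e a, by simp [dehom]⟩
  | add p q hp hq =>
    obtain ⟨n, A, hA, rfl⟩ := hp
    obtain ⟨m, B, hB, rfl⟩ := hq
    have key := isBihom_baseIdx_pow_mul_X3_pow e i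
    -- Powers of the base coordinate and of `z` dehomogenize to 1 and bring both summands to the
    -- common bidegree `n + m`.
    refine ⟨n + m, A * (X (baseIdx i) ^ m.1 * X 3 ^ m.2) + B * (X (baseIdx i) ^ n.1 * X 3 ^ n.2),
      isBihom_add (hA.mul (key m)) (by rw [add_comm n]; exact hB.mul (key n)), ?_⟩
    simp [dehom_X_baseIdx, dehom_X3]
  | mul_X p j hp =>
    obtain ⟨n, A, hA, rfl⟩ := hp
    fin_cases j
    · exact ⟨_, A * X (paramIdx i), hA.mul (isBihom_X_paramIdx e i), by simp [dehom_X_paramIdx]⟩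
    · exact ⟨_, A * X 2, hA.mul (isBihom_X2 e), by simp [dehom_X2]⟩

lemma dehom_surjective (i : Fin 2) : Function.Surjective (dehom i) := fun P => by
  obtain ⟨-, A, -, h⟩ := exists_isBihom_dehom_eq 0 i P
  exact ⟨A, h⟩

/-- Dehomogenization turns all coordinates but two into constants, so the chain rule leaves a single
term. -/
lemma pderiv_zero_dehom (i : Fin 2) (A : MvPolynomial (Fin 4) ℂ) :
    pderiv 0 (dehom i A) = dehom i (pderiv (paramIdx i) A) := by
  induction A using MvPolynomial.induction_on with
  | C a => simp [dehom]
  | add p q hp hq => simp [hp, hq]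
  | mul_X p j hp =>
    rw [map_mul, Derivation.leibniz, Derivation.leibniz, hp]
    fin_cases i <;> fin_cases j <;> simp [dehom, chartVec, paramIdx, pderiv_X]

lemma pderiv_one_dehom (i : Fin 2) (A : MvPolynomial (Fin 4) ℂ) :
    pderiv 1 (dehom i A) = dehom i (pderiv 2 A) := by
  induction A using MvPolynomial.induction_on with
  | C a => simp [dehom]
  | add p q hp hq => simp [hp, hq]
  | mul_X p j hp =>
    rw [map_mul, Derivation.leibniz, Derivation.leibniz, hp]
    fin_cases i <;> fin_cases j <;> simp [dehom, chartVec, pderiv_X]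

/-- The point of the `i`-th chart with affine coordinates `w`. -/
def chartCoord (i : Fin 2) (w : Fin 2 → ℂ) : Coord :=
  ⟨chartVec i (w 0) (w 1), by fin_cases i <;> simp [chartVec]⟩

lemma eval_chartCoord (i : Fin 2) (w : Fin 2 → ℂ) (A : MvPolynomial (Fin 4) ℂ) :
    eval (chartCoord i w).1 A = eval w (dehom i A) := by
  have := aeval_dehom i w A
  rw [aeval_eq_eval, aeval_eq_eval] at this
  exact this.symm

/-- The points off the section at infinity and off one of the two coordinate fibres are
the points of a chart. -/
lemma exists_eq_mk_chartCoord {e : ℕ} (i : Fin 2) (v : Coord) (hs : v.1 (baseIdx i) ≠ 0)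
    (hz : v.1 3 ≠ 0) : ∃ w, Ruled.mk e v = Ruled.mk e (chartCoord i w) := by
  let s := v.1 (baseIdx i)
  have hm : (s ^ e) ≠ 0 := pow_ne_zero _ hs
  -- The torus element `(1/s, 1/z)` normalizes the base coordinate and `z` to 1; it scales `x` by
  -- `s⁻ᵉ z⁻¹`.
  refine ⟨![v.1 (paramIdx i) / s, v.1 2 / (s ^ e * v.1 3)],
    mk_eq_mk.2 ⟨Units.mk0 s⁻¹ (inv_ne_zero hs), Units.mk0 (v.1 3)⁻¹ (inv_ne_zero hz), ?_⟩⟩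
  funext j
  fin_cases i <;> fin_cases j <;>
    simp [act, chartCoord, chartVec, s, baseIdx, paramIdx] at hs hz ⊢ <;> field_simp

end Ruled

/-! ### The affine equations of the curve, its function field and local rings -/

namespace WeierstrassModel

lemma isBihom_lift (e : ℕ) {a : MvPolynomial (Fin 2) ℂ} {n : ℕ} (ha : a.IsHomogeneous n) :
    IsBihom e (lift a) (n, 0) := by
  have ha' : a.IsWeightedHomogeneous 1 n := ha
  induction ha' using IsWeightedHomogeneous.induction_on with
  | zero => simpa [lift] using isWeightedHomogeneous_zero ℂ (weight e) (n, 0)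
  | add p q hp hq h1 h2 =>
    rw [lift, map_add]
    exact isBihom_add (h1 hp) (h2 hq)
  | monomial k r hk =>
    rw [Finsupp.weight_apply, Finsupp.sum_fintype _ _ (by simp), Fin.sum_univ_two] at hk
    simp only [Pi.one_apply, smul_eq_mul, mul_one] at hk
    have h : lift (monomial k r) = C r * (X 0 ^ k 0 * X 1 ^ k 1) := by
      rw [lift, monomial_eq, Finsupp.prod_fintype _ _ (fun _ => pow_zero _), Fin.prod_univ_two]
      simp
    have hm := (isBihom_C e r).mul (((isBihom_X0 e).pow (k 0)).mul ((isBihom_X1 e).pow (k 1)))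
    rw [h]
    convert hm using 1
    simp [← hk]

variable {d : ℕ} (W : WeierstrassModel d)

lemma isBihom_cubic : IsBihom (2 * d) W.cubic (6 * d, 3) := by
  refine isBihom_add (isBihom_add (isBihom_add ?_ ?_) ?_) ?_
  · convert (isBihom_X2 (2 * d)).pow 3 using 1
    exact Prod.ext (by simp; ring) (by simp)
  · convert ((isBihom_lift (2 * d) W.hom₂).mul ((isBihom_X2 (2 * d)).pow 2)).mul
      (isBihom_X3 (2 * d)) using 1
    exact Prod.ext (by simp; ring) (by simp)
  · convert ((isBihom_lift (2 * d) W.hom₄).mul (isBihom_X2 (2 * d))).mul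
      ((isBihom_X3 (2 * d)).pow 2) using 1
    exact Prod.ext (by simp; ring) (by simp)
  · convert (isBihom_lift (2 * d) W.hom₆).mul ((isBihom_X3 (2 * d)).pow 3) using 1
    ext <;> simp

lemma isBihom_pderiv_cubic : IsBihom (2 * d) (pderiv 2 W.cubic) (4 * d, 2) :=
  W.isBihom_cubic.pderiv (by ext <;> simp [weight]; ring)

/-- Dehomogenization on the `i`-th chart, as a polynomial in the fibre coordinate. -/
def polyChart (i : Fin 2) : MvPolynomial (Fin 4) ℂ →ₐ[ℂ] Polynomial (Polynomial ℂ) :=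
  aeval (chartVec i (Polynomial.C Polynomial.X) Polynomial.X)

lemma exists_polyChart_lift (i : Fin 2) (a : MvPolynomial (Fin 2) ℂ) :
    ∃ p : Polynomial ℂ, polyChart i (lift a) = Polynomial.C p := by
  induction a using MvPolynomial.induction_on with
  | C r => exact ⟨Polynomial.C r, by simp [polyChart, lift]⟩
  | add p q hp hq =>
    obtain ⟨a, ha⟩ := hp
    obtain ⟨b, hb⟩ := hq
    refine ⟨a + b, ?_⟩
    rw [lift] at ha hb ⊢
    rw [map_add, map_add, ha, hb, map_add]
  | mul_X p j hp =>
    obtain ⟨a, ha⟩ := hp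
    rw [lift] at ha
    rw [lift, map_mul, map_mul, ha, rename_X]
    fin_cases i <;> fin_cases j
    · exact ⟨a, by simp [polyChart, chartVec]⟩
    · exact ⟨a * Polynomial.X, by simp [polyChart, chartVec]⟩
    · exact ⟨a * Polynomial.X, by simp [polyChart, chartVec]⟩
    · exact ⟨a, by simp [polyChart, chartVec]⟩

lemma polyChart_X2 (i : Fin 2) : polyChart i (X 2) = Polynomial.X := by
  fin_cases i <;> simp [polyChart, chartVec]

lemma polyChart_X3 (i : Fin 2) : polyChart i (X 3) = 1 := by
  fin_cases i <;> simp [polyChart, chartVec]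

lemma polyChart_X_baseIdx (i : Fin 2) : polyChart i (X (baseIdx i)) = 1 := by
  fin_cases i <;> simp [polyChart, chartVec, baseIdx]

lemma polyChart_X_paramIdx (i : Fin 2) :
    polyChart i (X (paramIdx i)) = Polynomial.C Polynomial.X := by
  fin_cases i <;> simp [polyChart, chartVec, paramIdx]

lemma exists_polyChart_cubic (i : Fin 2) : ∃ p q r : Polynomial ℂ, polyChart i W.cubic =
    Polynomial.X ^ 3 + (Polynomial.C p * Polynomial.X ^ 2 + Polynomial.C q * Polynomial.X +
      Polynomial.C r) := by
  obtain ⟨p, hp⟩ := exists_polyChart_lift i W.a₂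
  obtain ⟨q, hq⟩ := exists_polyChart_lift i W.a₄
  obtain ⟨r, hr⟩ := exists_polyChart_lift i W.a₆
  refine ⟨p, q, r, ?_⟩
  simp only [cubic, map_add, map_mul, map_pow, hp, hq, hr, polyChart_X2, polyChart_X3]
  ring

/-- Monicity allows division with remainder over the polynomials in the base coordinate, so
functions on a chart are represented by polynomials of degree less than 3 in `x`. -/
lemma monic_polyChart_cubic (i : Fin 2) : (polyChart i W.cubic).Monic := by
  obtain ⟨p, q, r, hc⟩ := W.exists_polyChart_cubic i
  rw [hc]
  exact Polynomial.monic_X_pow_add (by compute_degree!)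

lemma degree_polyChart_cubic (i : Fin 2) : (polyChart i W.cubic).degree = 3 := by
  obtain ⟨p, q, r, hc⟩ := W.exists_polyChart_cubic i
  rw [hc]
  compute_degree!

/-- The equation of `𝒞` on the `i`-th chart. -/
def affineCubic (i : Fin 2) : MvPolynomial (Fin 2) ℂ := dehom i W.cubic

/-- The point of the `i`-th chart with affine coordinates `w`. -/
def chartPoint (d : ℕ) (i : Fin 2) (w : Fin 2 → ℂ) : Surface (2 * d) :=
  Ruled.mk (2 * d) (chartCoord i w)

lemma chartPoint_mem_branchCurve (i : Fin 2) (w : Fin 2 → ℂ) :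
    chartPoint d i w ∈ W.branchCurve ↔ eval w (W.affineCubic i) = 0 := by
  rw [chartPoint, mk_mem_branchCurve, eval_chartCoord, affineCubic]

variable [W.IsIrreducible]

/-- A polynomial of degree less than three in the fibre coordinate does not vanish on `𝒞`. -/
lemma polyChart_eq_zero_of_res_eq_zero (i : Fin 2) {A : MvPolynomial (Fin 4) ℂ}
    (h : W.res A = 0) (hdeg : (polyChart i A).degree < 3) : polyChart i A = 0 := by
  obtain ⟨B, rfl⟩ := (W.res_eq_zero_iff A).1 h
  refine Polynomial.eq_zero_of_dvd_of_degree_lt (p := polyChart i W.cubic) ?_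
    (by rwa [W.degree_polyChart_cubic])
  rw [map_mul]
  exact dvd_mul_right _ _

lemma res_X_baseIdx_ne_zero (i : Fin 2) : W.res (X (baseIdx i)) ≠ 0 := fun h => by
  have := W.polyChart_eq_zero_of_res_eq_zero i h (by rw [polyChart_X_baseIdx]; simp)
  rw [polyChart_X_baseIdx] at this
  exact one_ne_zero this

lemma res_X3_ne_zero : W.res (X 3) ≠ 0 := fun h => by
  have := W.polyChart_eq_zero_of_res_eq_zero 0 h (by rw [polyChart_X3]; simp)
  rw [polyChart_X3] at this
  exact one_ne_zero this

/-- The derivative has degree 2 in `x` with leading coefficient 3, too small a degree for a nonzero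
multiple of the cubic. -/
lemma res_pderiv_cubic_ne_zero : W.res (pderiv 2 W.cubic) ≠ 0 := fun h => by
  obtain ⟨p, hp⟩ := exists_polyChart_lift 0 W.a₂
  obtain ⟨q, hq⟩ := exists_polyChart_lift 0 W.a₄
  -- The coefficients `aᵢ` do not involve `x`.
  have key : ∀ a : MvPolynomial (Fin 2) ℂ, pderiv 2 (lift a) = 0 := fun a => by
    refine pderiv_eq_zero_of_notMem_vars fun hm => ?_
    obtain ⟨j, -, hj⟩ := Finset.mem_image.1 (vars_rename _ _ hm)
    fin_cases j <;> simp at hj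
  have hd : pderiv 2 W.cubic = 3 * X 2 ^ 2 + 2 * lift W.a₂ * X 2 * X 3 + lift W.a₄ * X 3 ^ 2 := by
    simp [cubic, key, pderiv_X]
    ring
  have hP : polyChart 0 (pderiv 2 W.cubic) = Polynomial.C (Polynomial.C 3) * Polynomial.X ^ 2 +
      Polynomial.C (2 * p) * Polynomial.X + Polynomial.C q := by
    have h2 : polyChart 0 2 = Polynomial.C 2 := map_ofNat _ 2
    have h3 : polyChart 0 3 = Polynomial.C (Polynomial.C 3) := by
      rw [map_ofNat, map_ofNat, map_ofNat]
    simp [hd, hp, hq, polyChart_X2, polyChart_X3, h2, h3]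
  have h3 : (Polynomial.C (3 : ℂ)) ≠ 0 := by simp
  have hdeg : (polyChart 0 (pderiv 2 W.cubic)).degree = 2 := by
    rw [hP]; exact Polynomial.degree_quadratic h3
  have := W.polyChart_eq_zero_of_res_eq_zero 0 h (by rw [hdeg]; decide)
  rw [this] at hdeg
  simp at hdeg

/-- The base coordinate of the `i`-th chart. -/
def baseFn (i : Fin 2) : W.functionField :=
  W.ratio (X (paramIdx i)) (X (baseIdx i)) (1, 0) (isBihom_X_paramIdx _ i) (isBihom_X_baseIdx _ i)

lemma isBihom_baseIdx_pow_mul_X3 (e : ℕ) (i : Fin 2) :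
    IsBihom e (X (baseIdx i) ^ e * X 3) (e, 1) := by
  simpa using ((isBihom_X_baseIdx e i).pow e).mul (isBihom_X3 e)

/-- The fibre coordinate of the `i`-th chart. -/
def fibreFn (i : Fin 2) : W.functionField :=
  W.ratio (X 2) (X (baseIdx i) ^ (2 * d) * X 3) (2 * d, 1) (isBihom_X2 _)
    (isBihom_baseIdx_pow_mul_X3 _ i)

/-- Polynomials in the affine coordinates of the `i`-th chart as rational functions. -/
def affineEval (i : Fin 2) : MvPolynomial (Fin 2) ℂ →ₐ[ℂ] W.functionField :=
  aeval ![W.baseFn i, W.fibreFn i]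

lemma affineEval_X0 (i : Fin 2) : W.affineEval i (X 0) = W.baseFn i := by simp [affineEval]
lemma affineEval_X1 (i : Fin 2) : W.affineEval i (X 1) = W.fibreFn i := by simp [affineEval]

lemma coe_affineEval (i : Fin 2) (P : MvPolynomial (Fin 2) ℂ) :
    (W.affineEval i P : FractionRing W.CoordRing) =
      aeval ![W.res (X (paramIdx i)) / W.res (X (baseIdx i)),
        W.res (X 2) / (W.res (X (baseIdx i)) ^ (2 * d) * W.res (X 3))] P := by
  rw [affineEval, ← IntermediateField.coe_val, ← AlgHom.comp_apply, comp_aeval]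
  congr 2
  funext j
  fin_cases j <;> simp [baseFn, fibreFn, ratio]

lemma res_eq_affineEval (i : Fin 2) {A : MvPolynomial (Fin 4) ℂ} {n : ℕ × ℕ}
    (hA : IsBihom (2 * d) A n) : W.res A = W.res (X (baseIdx i)) ^ n.1 * W.res (X 3) ^ n.2 *
      W.affineEval i (dehom i A) := by
  rw [coe_affineEval]
  exact map_eq_aeval_dehom W.res i hA (W.res_X_baseIdx_ne_zero i) W.res_X3_ne_zero

lemma res_eq_zero_iff_affineEval (i : Fin 2) {A : MvPolynomial (Fin 4) ℂ} {n : ℕ × ℕ}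
    (hA : IsBihom (2 * d) A n) : W.res A = 0 ↔ W.affineEval i (dehom i A) = 0 := by
  have h1 := pow_ne_zero n.1 (W.res_X_baseIdx_ne_zero i)
  have h2 := pow_ne_zero n.2 W.res_X3_ne_zero
  rw [W.res_eq_affineEval i hA]
  simp only [mul_eq_zero, h1, h2, false_or]
  exact_mod_cast Iff.rfl

lemma affineEval_affineCubic (i : Fin 2) : W.affineEval i (W.affineCubic i) = 0 :=
  (W.res_eq_zero_iff_affineEval i W.isBihom_cubic).1 ((W.res_eq_zero_iff _).2 dvd_rfl)

lemma affineEval_pderiv_ne_zero (i : Fin 2) :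
    W.affineEval i (pderiv 1 (W.affineCubic i)) ≠ 0 := by
  rw [affineCubic, pderiv_one_dehom, ne_eq, ← W.res_eq_zero_iff_affineEval i W.isBihom_pderiv_cubic]
  exact W.res_pderiv_cubic_ne_zero

/-- The homogenizing factors depend only on the bidegree, so they cancel in the quotient. -/
lemma ratio_eq_div (i : Fin 2) {A B : MvPolynomial (Fin 4) ℂ} {n : ℕ × ℕ}
    (hA : IsBihom (2 * d) A n) (hB : IsBihom (2 * d) B n) :
    W.ratio A B n hA hB = W.affineEval i (dehom i A) / W.affineEval i (dehom i B) := by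
  apply Subtype.ext
  change W.res A / W.res B = _
  have h1 := pow_ne_zero n.1 (W.res_X_baseIdx_ne_zero i)
  have h2 := pow_ne_zero n.2 W.res_X3_ne_zero
  rw [W.res_eq_affineEval i hA, W.res_eq_affineEval i hB,
    mul_div_mul_left _ _ (mul_ne_zero h1 h2)]
  rfl

/-- The function field is generated by the affine coordinates. -/
lemma exists_eq_affineEval_div (i : Fin 2) (f : W.functionField) :
    ∃ a b, W.affineEval i b ≠ 0 ∧ f = W.affineEval i a / W.affineEval i b := by
  obtain ⟨f, n, A, B, hA, hB, h0, rfl⟩ := f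
  exact ⟨dehom i A, dehom i B, (W.res_eq_zero_iff_affineEval i hB).not.1 h0,
    W.ratio_eq_div i hA hB⟩

lemma affineEval_ne_zero {i : Fin 2} {w : Fin 2 → ℂ} (hw : eval w (W.affineCubic i) = 0)
    {b : MvPolynomial (Fin 2) ℂ} (hb : eval w b ≠ 0) : W.affineEval i b ≠ 0 := by
  obtain ⟨n, B, hB, rfl⟩ := exists_isBihom_dehom_eq (2 * d) i b
  refine (W.res_eq_zero_iff_affineEval i hB).not.1
    (W.res_ne_zero ((W.chartPoint_mem_branchCurve i w).2 hw) ?_)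
  rwa [chartPoint, mk_mem_zeroLocus_iff hB, eval_chartCoord]

/-- Identifies the local ring, defined by bihomogeneous fractions, with the localization at `w` of
the affine coordinate ring. -/
lemma mem_localRing_chartPoint_iff {i : Fin 2} {w : Fin 2 → ℂ}
    (hw : eval w (W.affineCubic i) = 0) (f : W.functionField) :
    f ∈ W.localRing (chartPoint d i w) ↔
      ∃ a b, eval w b ≠ 0 ∧ f = W.affineEval i a / W.affineEval i b := by
  constructor
  · rintro ⟨n, A, B, hA, hB, -, hp, hf⟩
    rw [chartPoint, mk_mem_zeroLocus_iff hB, eval_chartCoord] at hp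
    refine ⟨dehom i A, dehom i B, hp, ?_⟩
    rw [← W.ratio_eq_div i hA hB]
    exact Subtype.ext hf
  · rintro ⟨a, b, hb, rfl⟩
    have hb0 := W.affineEval_ne_zero hw hb
    obtain ⟨n, A, hA, rfl⟩ := exists_isBihom_dehom_eq (2 * d) i a
    obtain ⟨m, B, hB, rfl⟩ := exists_isBihom_dehom_eq (2 * d) i b
    -- Padding gives numerator and denominator the common bidegree `n + m` without changing their
    -- dehomogenizations.
    have key := isBihom_baseIdx_pow_mul_X3_pow (2 * d) i
    have hA' := hA.mul (key m)
    have hB' := (key n).mul hB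
    have hdA : dehom i (A * (X (baseIdx i) ^ m.1 * X 3 ^ m.2)) = dehom i A := by
      simp [dehom_X_baseIdx, dehom_X3]
    have hdB : dehom i (X (baseIdx i) ^ n.1 * X 3 ^ n.2 * B) = dehom i B := by
      simp [dehom_X_baseIdx, dehom_X3]
    refine ⟨n + m, _, _, hA', hB', ?_, ?_, ?_⟩
    · rwa [ne_eq, W.res_eq_zero_iff_affineEval i hB', hdB]
    · rwa [chartPoint, mk_mem_zeroLocus_iff hB', eval_chartCoord, hdB]
    · have := W.ratio_eq_div i hA' hB'
      rw [hdA, hdB] at this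
      rw [← this]
      rfl

end WeierstrassModel

/-! ### Taylor expansion and local parameters -/

namespace MvPolynomial

/-- First order Taylor expansion in two variables. -/
lemma exists_taylor_fin_two {R : Type*} [CommRing R] (w : Fin 2 → R) (a : MvPolynomial (Fin 2) R) :
    ∃ α β, a = C (eval w a) + (X 0 - C (w 0)) * α + (X 1 - C (w 1)) * β ∧
      eval w α = eval w (pderiv 0 a) ∧ eval w β = eval w (pderiv 1 a) := by
  have h : ∃ α β, a = C (eval w a) + (X 0 - C (w 0)) * α + (X 1 - C (w 1)) * β := by
    induction a using MvPolynomial.induction_on with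
    | C r => exact ⟨0, 0, by simp⟩
    | add p q hp hq =>
      obtain ⟨α, β, h⟩ := hp
      obtain ⟨α', β', h'⟩ := hq
      refine ⟨α + α', β + β', ?_⟩
      rw [map_add, map_add]
      linear_combination h + h'
    | mul_X p j hp =>
      obtain ⟨α, β, h⟩ := hp
      fin_cases j
      · refine ⟨α * X 0 + C (eval w p), β * X 0, ?_⟩
        simp only [map_mul, eval_X, Fin.zero_eta]
        linear_combination X 0 * h
      · refine ⟨α * X 1, β * X 1 + C (eval w p), ?_⟩
        simp only [map_mul, eval_X, Fin.mk_one]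
        linear_combination X 1 * h
  -- Differentiating the expansion and evaluating at `w`, where the linear factors vanish, gives the
  -- values of `α` and `β`.
  obtain ⟨α, β, h⟩ := h
  refine ⟨α, β, h, ?_, ?_⟩
  · have := congrArg (fun b => eval w (pderiv 0 b)) h
    simp [pderiv_X] at this
    exact this.symm
  · have := congrArg (fun b => eval w (pderiv 1 b)) h
    simp [pderiv_X] at this
    exact this.symm

end MvPolynomial

namespace WeierstrassModel

variable {d : ℕ} (W : WeierstrassModel d)

/-- The Jacobian criterion on a chart. -/
lemma IsSmooth.eval_pderiv_affineCubic {W : WeierstrassModel d} (hW : W.IsSmooth) {i : Fin 2}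
    {w : Fin 2 → ℂ} (hw : eval w (W.affineCubic i) = 0) :
    eval w (pderiv 0 (W.affineCubic i)) ≠ 0 ∨ eval w (pderiv 1 (W.affineCubic i)) ≠ 0 := by
  by_contra! h
  obtain ⟨h0, h1⟩ := h
  rw [affineCubic, pderiv_zero_dehom, ← eval_chartCoord] at h0
  rw [affineCubic, pderiv_one_dehom, ← eval_chartCoord] at h1
  obtain ⟨j, hj⟩ := hW (chartCoord i w) ((W.chartPoint_mem_branchCurve i w).2 hw)
  have hc : eval (chartCoord i w).1 W.cubic = 0 := by rwa [eval_chartCoord]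
  -- `IsSmooth` involves four partial derivatives and the chart sees two. Euler's relations for the
  -- two gradings, at a point where the base coordinate and `z` are 1, force the other two to vanish
  -- as well.
  have e1 : W.cubic.IsWeightedHomogeneous (fun k => (weight (2 * d) k).1) (6 * d) := by
    intro k hk
    have := congrArg Prod.fst (W.isBihom_cubic hk)
    rw [weight_apply_fin4] at this
    rw [Finsupp.weight_apply, Finsupp.sum_fintype _ _ (by simp), Fin.sum_univ_four]
    simpa [weight] using this
  have e2 : W.cubic.IsWeightedHomogeneous (fun k => (weight (2 * d) k).2) 3 := by
    intro k hk
    have := congrArg Prod.snd (W.isBihom_cubic hk)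
    rw [weight_apply_fin4] at this
    rw [Finsupp.weight_apply, Finsupp.sum_fintype _ _ (by simp), Fin.sum_univ_four]
    simpa [weight] using this
  have E1 := congrArg (eval (chartCoord i w).1) e1.sum_weight_X_mul_pderiv
  have E2 := congrArg (eval (chartCoord i w).1) e2.sum_weight_X_mul_pderiv
  simp only [Fin.sum_univ_four, map_add, map_nsmul, map_mul, eval_X, h1, hc] at E1 E2
  fin_cases i
  · simp only [paramIdx, Fin.zero_eta, Matrix.cons_val_zero] at h0
    simp [chartCoord, chartVec, weight] at E1 E2 h0 h1 hj
    simp [h0] at E1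
    fin_cases j <;> simp_all
  · simp only [paramIdx, Fin.mk_one, Matrix.cons_val_one] at h0
    simp [chartCoord, chartVec, weight] at E1 E2 h0 h1 hj
    simp [h0] at E1
    fin_cases j <;> simp_all

variable [W.IsIrreducible]

variable {W} {i : Fin 2} {w : Fin 2 → ℂ} (hw : eval w (W.affineCubic i) = 0)

/-- The germ at a point of a polynomial in the affine coordinates. -/
def germ : MvPolynomial (Fin 2) ℂ →ₐ[ℂ] W.localRing (chartPoint d i w) :=
  (W.affineEval i).codRestrict _ fun a =>
    (W.mem_localRing_chartPoint_iff hw _).2 ⟨a, 1, by simp, by simp⟩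

lemma coe_germ (a : MvPolynomial (Fin 2) ℂ) :
    (germ hw a : W.functionField) = W.affineEval i a := rfl

lemma germ_affineCubic : germ hw (W.affineCubic i) = 0 :=
  Subtype.ext (W.affineEval_affineCubic i)

lemma isUnit_germ_iff (a : MvPolynomial (Fin 2) ℂ) : IsUnit (germ hw a) ↔ eval w a ≠ 0 := by
  constructor
  · intro hu ha
    obtain ⟨r, hr⟩ := hu.exists_right_inv
    obtain ⟨b, c, hc, hrb⟩ := (W.mem_localRing_chartPoint_iff hw _).1 r.2
    have hc0 := W.affineEval_ne_zero hw hc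
    have h1 : W.affineEval i a * (W.affineEval i b / W.affineEval i c) = 1 := by
      rw [← hrb]; exact congrArg Subtype.val hr
    rw [← mul_div_assoc, div_eq_one_iff_eq hc0] at h1
    -- If `b / c` inverts `a`, then `a * b - c` is zero as a function on `𝒞`; but its value at `w`
    -- is `-c(w) ≠ 0`.
    refine W.affineEval_ne_zero hw (b := a * b - c) ?_ (by rw [map_sub, map_mul, h1, sub_self])
    simpa [ha] using hc
  · intro ha
    have ha0 := W.affineEval_ne_zero hw ha
    refine IsUnit.of_mul_eq_one ⟨1 / W.affineEval i a,
      (W.mem_localRing_chartPoint_iff hw _).2 ⟨1, a, ha, by simp⟩⟩ (Subtype.ext ?_)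
    change W.affineEval i a * (1 / W.affineEval i a) = 1
    field_simp

lemma exists_mul_germ_eq (r : W.localRing (chartPoint d i w)) :
    ∃ a b, IsUnit (germ hw b) ∧ r * germ hw b = germ hw a := by
  obtain ⟨a, b, hb, h⟩ := (W.mem_localRing_chartPoint_iff hw _).1 r.2
  refine ⟨a, b, (isUnit_germ_iff hw b).2 hb, Subtype.ext ?_⟩
  change (r : W.functionField) * W.affineEval i b = W.affineEval i a
  rw [h, div_mul_cancel₀ _ (W.affineEval_ne_zero hw hb)]

/-- Every element is the germ of a polynomial up to a unit, so an ideal is determined by its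
preimage in the polynomial ring, and ascending chains stop there. -/
lemma isNoetherianRing_localRing (hw : eval w (W.affineCubic i) = 0) :
    IsNoetherianRing (W.localRing (chartPoint d i w)) := by
  rw [isNoetherianRing_iff, isNoetherian_iff']
  have hinj : ∀ I J : Ideal (W.localRing (chartPoint d i w)),
      I.comap (germ hw) ≤ J.comap (germ hw) ↔ I ≤ J := by
    refine fun I J => ⟨fun h r hr => ?_, fun h => Ideal.comap_mono h⟩
    obtain ⟨a, b, hb, hab⟩ := exists_mul_germ_eq hw r
    have ha : a ∈ I.comap (germ hw) := by
      rw [Ideal.mem_comap, ← hab]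
      exact I.mul_mem_right _ hr
    have := h ha
    rw [Ideal.mem_comap, ← hab] at this
    exact (Ideal.mul_unit_mem_iff_mem _ hb).1 this
  exact (OrderEmbedding.ofMapLEIff (fun I : Ideal (W.localRing (chartPoint d i w)) =>
    I.comap (germ hw)) hinj).wellFoundedGT

/-- By Taylor expansion the two coordinate differences generate the ideal of non-units; a non-unit
dividing both therefore generates it alone. -/
lemma isUniformizer_of_dvd {π : W.localRing (chartPoint d i w)} (hπ : ¬ IsUnit π)
    (h0 : π ∣ germ hw (X 0 - C (w 0))) (h1 : π ∣ germ hw (X 1 - C (w 1))) :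
    W.IsUniformizer (chartPoint d i w) π := by
  intro r
  refine ⟨fun h hu => hπ (isUnit_of_dvd_unit h hu), fun hr => ?_⟩
  obtain ⟨a, b, hb, hab⟩ := exists_mul_germ_eq hw r
  have ha : eval w a = 0 := by
    by_contra ha
    rw [← ne_eq, ← isUnit_germ_iff hw, ← hab] at ha
    exact hr (isUnit_of_mul_isUnit_left ha)
  obtain ⟨α, β, h, -⟩ := exists_taylor_fin_two w a
  rw [← hb.dvd_mul_right, hab, h, ha]
  simp only [map_zero, zero_add, map_add, map_mul]
  exact dvd_add (h0.mul_right _) (h1.mul_right _)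

/-- At a point where the fibre coordinate has nonvanishing partial derivative the base coordinate
is a local parameter, and vice versa. -/
lemma isUniformizer_germ :
    (eval w (pderiv 1 (W.affineCubic i)) ≠ 0 →
      W.IsUniformizer (chartPoint d i w) (germ hw (X 0 - C (w 0)))) ∧
    (eval w (pderiv 0 (W.affineCubic i)) ≠ 0 →
      W.IsUniformizer (chartPoint d i w) (germ hw (X 1 - C (w 1)))) := by
  obtain ⟨α, β, h, hα, hβ⟩ := exists_taylor_fin_two w (W.affineCubic i)
  rw [hw] at h
  -- On `𝒞` the expansion reads `0 = (u - u₀) α + (x - x₀) β`. Where `β` is a unit, `u - u₀` divides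
  -- `x - x₀`, and symmetrically for `α`.
  have hg := congrArg (germ hw) h
  rw [germ_affineCubic, map_zero, zero_add, map_add, map_mul (germ hw), map_mul (germ hw)] at hg
  constructor
  · intro h1
    rw [← hβ, ← isUnit_germ_iff hw] at h1
    refine isUniformizer_of_dvd hw (by rw [isUnit_germ_iff]; simp) dvd_rfl ?_
    rw [← h1.dvd_mul_right]
    exact ⟨-germ hw α, by linear_combination -hg⟩
  · intro h1
    rw [← hα, ← isUnit_germ_iff hw] at h1
    refine isUniformizer_of_dvd hw (by rw [isUnit_germ_iff]; simp) ?_ dvd_rfl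
    rw [← h1.dvd_mul_right]
    exact ⟨-germ hw β, by linear_combination -hg⟩

lemma IsSmooth.exists_isUniformizer (hW : W.IsSmooth) (hw : eval w (W.affineCubic i) = 0) :
    ∃ π, W.IsUniformizer (chartPoint d i w) π :=
  (hW.eval_pderiv_affineCubic hw).elim (fun h => ⟨_, (isUniformizer_germ hw).2 h⟩)
    (fun h => ⟨_, (isUniformizer_germ hw).1 h⟩)

end WeierstrassModel

/-! ### Orders of rational functions -/

namespace WeierstrassModel

variable {d : ℕ} {W : WeierstrassModel d}

open Classical in
/-- The index of a chart that contains `p`, chosen so that `denom p` is its base coordinate. -/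
def chartIdx (p : Surface (2 * d)) : Fin 2 := if p ∈ zeroLocus (2 * d) (X 0) then 1 else 0

lemma denom_eq (p : Surface (2 * d)) : denom p = X (baseIdx (chartIdx p)) := by
  unfold denom chartIdx
  split_ifs <;> rfl

/-- `𝒞` misses the section at infinity, so the two affine charts cover it. -/
lemma exists_eq_chartPoint {p : Surface (2 * d)} (hp : p ∈ W.branchCurve) :
    ∃ w, p = chartPoint d (chartIdx p) w ∧ eval w (W.affineCubic (chartIdx p)) = 0 := by
  obtain ⟨v, rfl⟩ : ∃ v, Ruled.mk (2 * d) v = p := Quotient.exists_rep p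
  have h3 : v.1 3 ≠ 0 := fun h => hp.2 ((mk_mem_sectionAtInfinity _ v).2 h)
  have hs := notMem_zeroLocus_denom (Ruled.mk (2 * d) v)
  rw [denom_eq, mk_mem_zeroLocus_iff (isBihom_X_baseIdx _ _), eval_X] at hs
  obtain ⟨w, hw⟩ := exists_eq_mk_chartCoord (e := 2 * d) _ v hs h3
  refine ⟨w, hw, (W.chartPoint_mem_branchCurve _ w).1 ?_⟩
  rw [chartPoint, ← hw]
  exact hp

variable [W.IsIrreducible] {p : Surface (2 * d)}

lemma res_fibreForm_ne_zero {c : Fin 2 → ℂ} (hc : c ≠ 0) : W.res (fibreForm c) ≠ 0 := by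
  intro h
  have hP : polyChart 0 (fibreForm c) =
      Polynomial.C (Polynomial.C (c 1) - Polynomial.C (c 0) * Polynomial.X) := by
    have hC : ∀ a : ℂ, polyChart 0 (C a) = Polynomial.C (Polynomial.C a) := fun a => by
      simp [polyChart]
    have h0 : polyChart 0 (X 0) = 1 := polyChart_X_baseIdx 0
    have h1 : polyChart 0 (X 1) = Polynomial.C Polynomial.X := polyChart_X_paramIdx 0
    rw [fibreForm, map_sub, map_mul, map_mul, hC, hC, h0, h1]
    simp
  have h0 := W.polyChart_eq_zero_of_res_eq_zero 0 h
    (by rw [hP]; exact Polynomial.degree_C_le.trans_lt (by decide))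
  rw [hP, Polynomial.C_eq_zero] at h0
  refine hc (funext fun j => ?_)
  fin_cases j
  · simpa [Polynomial.coeff_C] using congrArg (fun q => Polynomial.coeff q 1) h0
  · simpa using congrArg (fun q => Polynomial.coeff q 0) h0

/-- A nonzero polynomial free of `x` is not divisible by the cubic. Consequently the local rings
contain a nonzero non-unit, and zero is never a local parameter. -/
lemma baseFn_ne_algebraMap (i : Fin 2) (a : ℂ) : W.affineEval i (X 0 - C a) ≠ 0 := by
  have hA : IsBihom (2 * d) (X (paramIdx i) - C a * X (baseIdx i)) (1, 0) := by
    have := (isBihom_C (2 * d) a).mul (isBihom_X_baseIdx (2 * d) i)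
    rw [zero_add] at this
    exact (isBihom_X_paramIdx _ i).sub this
  have hd : dehom i (X (paramIdx i) - C a * X (baseIdx i)) = X 0 - C a := by
    rw [map_sub, map_mul, dehom_X_paramIdx, dehom_X_baseIdx, mul_one]
    simp [dehom]
  rw [← hd, ne_eq, ← W.res_eq_zero_iff_affineEval i hA]
  intro h
  have hP : polyChart i (X (paramIdx i) - C a * X (baseIdx i)) =
      Polynomial.C (Polynomial.X - Polynomial.C a) := by
    have hC : polyChart i (C a) = Polynomial.C (Polynomial.C a) := by simp [polyChart]
    rw [map_sub, map_mul, hC, polyChart_X_paramIdx, polyChart_X_baseIdx]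
    simp
  have h0 := W.polyChart_eq_zero_of_res_eq_zero i h
    (by rw [hP]; exact Polynomial.degree_C_le.trans_lt (by decide))
  rw [hP, Polynomial.C_eq_zero] at h0
  exact Polynomial.X_sub_C_ne_zero a h0

lemma IsUniformizer.ne_zero {π : W.localRing p} (h : W.IsUniformizer p π)
    (hp : p ∈ W.branchCurve) : π ≠ 0 := by
  rintro rfl
  obtain ⟨w, hpw, hw⟩ := exists_eq_chartPoint hp
  generalize chartIdx p = i at hpw hw
  subst hpw
  have hn : ¬ IsUnit (germ hw (X 0 - C (w 0))) := by rw [isUnit_germ_iff]; simp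
  have h0 := zero_dvd_iff.1 ((h _).2 hn)
  exact baseFn_ne_algebraMap i (w 0) (congrArg Subtype.val h0)

lemma IsUniformizer.coe_ne_zero {π : W.localRing p} (h : W.IsUniformizer p π)
    (hp : p ∈ W.branchCurve) : (π : W.functionField) ≠ 0 :=
  fun h0 => h.ne_zero hp (Subtype.ext h0)

lemma IsUniformizer.exists_unit_mul_eq {π π' : W.localRing p} (h : W.IsUniformizer p π)
    (h' : W.IsUniformizer p π') : ∃ u : (W.localRing p)ˣ, π' = u * π := by
  have h1 : π ∣ π' := (h _).2 ((h' _).1 dvd_rfl)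
  have h2 : π' ∣ π := (h' _).2 ((h _).1 dvd_rfl)
  obtain ⟨u, hu⟩ := associated_of_dvd_dvd h1 h2
  exact ⟨u, by rw [mul_comm, hu]⟩

/-- Units of the local ring as units of the function field. -/
def unitsCoe (p : Surface (2 * d)) : (W.localRing p)ˣ →* W.functionFieldˣ :=
  Units.map (W.localRing p).val.toRingHom.toMonoidHom

lemma coe_unitsCoe (u : (W.localRing p)ˣ) :
    ((unitsCoe p u : W.functionFieldˣ) : W.functionField) = (u : W.localRing p) := rfl

/-- Two local parameters divide each other, hence differ by a unit whose `n`-th power is absorbed.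
The order may thus be tested against any parameter. -/
lemma HasOrd.exists_unit {f : W.functionField} {n : ℤ} (h : W.HasOrd p f n) {π : W.localRing p}
    (hπ : W.IsUniformizer p π) :
    ∃ u : (W.localRing p)ˣ, f = (u : W.localRing p) * (π : W.functionField) ^ n := by
  obtain ⟨π', u, hπ', rfl⟩ := h
  obtain ⟨v, rfl⟩ := hπ.exists_unit_mul_eq hπ'
  refine ⟨u * v ^ n, ?_⟩
  rw [← coe_unitsCoe, ← coe_unitsCoe, map_mul, map_zpow, Units.val_mul, Units.val_zpow_eq_zpow_val,
    mul_assoc, coe_unitsCoe v, ← mul_zpow]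
  rfl

lemma HasOrd.mul (hp : p ∈ W.branchCurve) {f g : W.functionField} {m n : ℤ}
    (hf : W.HasOrd p f m) (hg : W.HasOrd p g n) : W.HasOrd p (f * g) (m + n) := by
  obtain ⟨π, u, hπ, rfl⟩ := hf
  obtain ⟨v, rfl⟩ := hg.exists_unit hπ
  refine ⟨π, u * v, hπ, ?_⟩
  rw [zpow_add₀ (hπ.coe_ne_zero hp)]
  push_cast
  ring

lemma HasOrd.zpow {f : W.functionField} {m : ℤ} (hf : W.HasOrd p f m) (k : ℤ) :
    W.HasOrd p (f ^ k) (k * m) := by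
  obtain ⟨π, u, hπ, rfl⟩ := hf
  refine ⟨π, u ^ k, hπ, ?_⟩
  rw [← coe_unitsCoe, ← coe_unitsCoe, map_zpow, Units.val_zpow_eq_zpow_val, mul_zpow,
    ← zpow_mul, mul_comm k m]

/-- Makes the choice of a local equation in the definition of `H0` immaterial. -/
lemma HasOrd.eq_unit_mul {f g : W.functionField} {n : ℤ} (hf : W.HasOrd p f n)
    (hg : W.HasOrd p g n) : ∃ u : (W.localRing p)ˣ, f = (u : W.localRing p) * g := by
  obtain ⟨π, u, hπ, rfl⟩ := hf
  obtain ⟨v, rfl⟩ := hg.exists_unit hπ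
  refine ⟨u * v⁻¹, ?_⟩
  have : ((u : W.localRing p) : W.functionField) =
      ((u * v⁻¹ : (W.localRing p)ˣ) : W.localRing p) * (v : W.localRing p) := by
    rw [← MulMemClass.coe_mul, ← Units.val_mul, inv_mul_cancel_right]
  rw [this, mul_assoc]

lemma unit_mul_mem_localRing_iff (u : (W.localRing p)ˣ) (f : W.functionField) :
    ((u : W.localRing p) : W.functionField) * f ∈ W.localRing p ↔ f ∈ W.localRing p := by
  refine ⟨fun h => ?_, fun h => mul_mem (SetLike.coe_mem _) h⟩
  have := mul_mem (SetLike.coe_mem ((u⁻¹ : (W.localRing p)ˣ) : W.localRing p)) h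
  rwa [← mul_assoc, ← MulMemClass.coe_mul, Units.inv_mul, OneMemClass.coe_one, one_mul] at this

lemma IsSmooth.exists_uniformizer (hW : W.IsSmooth) (hp : p ∈ W.branchCurve) :
    ∃ π, W.IsUniformizer p π := by
  obtain ⟨w, hpw, hw⟩ := exists_eq_chartPoint hp
  generalize chartIdx p = i at hpw hw
  subst hpw
  exact hW.exists_isUniformizer hw

lemma IsSmooth.hasOrd_unit (hW : W.IsSmooth) (hp : p ∈ W.branchCurve) (u : (W.localRing p)ˣ) :
    W.HasOrd p ((u : W.localRing p) : W.functionField) 0 := by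
  obtain ⟨π, hπ⟩ := hW.exists_uniformizer hp
  exact ⟨π, u, hπ, by simp⟩

lemma exists_eq_div_of_mem_localRing (hp : p ∈ W.branchCurve) (f : W.functionField) :
    ∃ a b : W.localRing p, b ≠ 0 ∧ f = (a : W.functionField) / b := by
  obtain ⟨w, hpw, hw⟩ := exists_eq_chartPoint hp
  generalize chartIdx p = i at hpw hw
  subst hpw
  obtain ⟨a, b, hb, rfl⟩ := W.exists_eq_affineEval_div i f
  exact ⟨germ hw a, germ hw b, fun h => hb (congrArg Subtype.val h), rfl⟩

/-- Nonzero functions on a smooth curve have an order at each point. -/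
lemma IsSmooth.exists_hasOrd (hW : W.IsSmooth) (hp : p ∈ W.branchCurve) {f : W.functionField}
    (hf : f ≠ 0) : ∃ n, W.HasOrd p f n := by
  obtain ⟨π, hπ⟩ := hW.exists_uniformizer hp
  have hN : IsNoetherianRing (W.localRing p) := by
    obtain ⟨w, hpw, hw⟩ := exists_eq_chartPoint hp
    rw [hpw]
    exact isNoetherianRing_localRing hw
  have key : ∀ a : W.localRing p, a ≠ 0 → ∃ n, W.HasOrd p (a : W.functionField) n := by
    intro a ha
    -- In a Noetherian domain a nonzero element is divisible by only finitely many powers of a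
    -- non-unit. The remaining cofactor is not a multiple of `π`, hence is a unit.
    have hfin : FiniteMultiplicity π a :=
      FiniteMultiplicity.of_not_isUnit ((hπ π).1 dvd_rfl) ha
    obtain ⟨b, hab, hb⟩ := hfin.exists_eq_pow_mul_and_not_dvd
    have hu : IsUnit b := by
      by_contra hu
      exact hb ((hπ b).2 hu)
    refine ⟨multiplicity π a, π, hu.unit, hπ, ?_⟩
    conv_lhs => rw [hab]
    rw [zpow_natCast, mul_comm]
    rfl
  obtain ⟨a, b, hb, rfl⟩ := exists_eq_div_of_mem_localRing hp f
  have ha : a ≠ 0 := by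
    rintro rfl
    exact hf (by simp)
  obtain ⟨m, hm⟩ := key a ha
  obtain ⟨n, hn⟩ := key b hb
  refine ⟨m + (-1) * n, ?_⟩
  rw [div_eq_mul_inv, ← zpow_neg_one]
  exact hm.mul hp (hn.zpow (-1))

lemma hasOrd_ord {f : W.functionField} (h : ∃ n, W.HasOrd p f n) : W.HasOrd p f (W.ord p f) := by
  rw [ord, dif_pos h]
  exact h.choose_spec

lemma fibreEquation_ne_zero {c : Fin 2 → ℂ} (hc : c ≠ 0) (p : Surface (2 * d)) :
    W.fibreEquation c p ≠ 0 := by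
  have h : W.res (fibreForm c) / W.res (denom p) ≠ 0 := by
    rw [denom_eq]
    exact div_ne_zero (res_fibreForm_ne_zero hc) (W.res_X_baseIdx_ne_zero _)
  intro h0
  refine h ?_
  rw [← ZeroMemClass.coe_zero W.functionField, ← h0]
  rfl

/-- The local equation is nonzero and so has an order on a smooth curve; the default value of `ord`
never enters `fibreDivisor`. -/
lemma IsSmooth.hasOrd_fibreEquation (hW : W.IsSmooth) {c : Fin 2 → ℂ} (hc : c ≠ 0)
    (p : W.branchCurve) : W.HasOrd p (W.fibreEquation c p) (W.fibreDivisor c hc p) := by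
  have := hasOrd_ord (hW.exists_hasOrd p.2 (fibreEquation_ne_zero hc p.1))
  exact this

end WeierstrassModel

/-! ### Sections of multiples of a fibre -/

namespace WeierstrassModel

lemma exists_degree_lt_three_coeff_eq {R : Type*} [CommRing R] (c : Fin 3 → R) :
    ∃ S : Polynomial R, S.degree < 3 ∧ ∀ j : Fin 3, S.coeff j = c j := by
  refine ⟨∑ j : Fin 3, Polynomial.C (c j) * Polynomial.X ^ (j : ℕ), ?_, fun j => ?_⟩
  · refine (Polynomial.degree_sum_le _ _).trans_lt ?_
    rw [Finset.sup_lt_iff (by decide)]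
    intro j _
    refine (Polynomial.degree_C_mul_X_pow_le _ _).trans_lt ?_
    exact_mod_cast j.2
  · simp only [Fin.sum_univ_three, Polynomial.coeff_add, Polynomial.coeff_C_mul,
      Polynomial.coeff_X_pow]
    fin_cases j <;> simp

variable {d : ℕ} (W : WeierstrassModel d) [W.IsIrreducible]

/-- Functions that are regular on the `i`-th chart are polynomials in the affine coordinates. -/
lemma exists_eq_affineEval_of_regular (i : Fin 2) (g : W.functionField)
    (hg : ∀ w, eval w (W.affineCubic i) = 0 → g ∈ W.localRing (chartPoint d i w)) :
    ∃ P, g = W.affineEval i P := by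
  -- The ideal of denominators of `g`. If it were proper, the Nullstellensatz would give a common
  -- zero `w`; it lies on `𝒞` because the cubic belongs to `I`, and regularity at `w` supplies a
  -- denominator that is nonzero there.
  let I : Ideal (MvPolynomial (Fin 2) ℂ) :=
    { carrier := {b | ∃ a, W.affineEval i b * g = W.affineEval i a}
      add_mem' := by
        rintro b b' ⟨a, ha⟩ ⟨a', ha'⟩
        exact ⟨a + a', by rw [map_add, add_mul, ha, ha', map_add]⟩
      zero_mem' := ⟨0, by simp⟩
      smul_mem' := by
        rintro c b ⟨a, ha⟩
        exact ⟨c * a, by rw [smul_eq_mul, map_mul, mul_assoc, ha, map_mul]⟩ }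
  by_cases hI : I = ⊤
  · obtain ⟨a, ha⟩ : (1 : MvPolynomial (Fin 2) ℂ) ∈ I := hI ▸ Submodule.mem_top
    exact ⟨a, by rw [← ha, map_one, one_mul]⟩
  · obtain ⟨M, hM, hIM⟩ := Ideal.exists_le_maximal I hI
    obtain ⟨w, rfl⟩ := isMaximal_iff_eq_vanishingIdeal_singleton.1 hM
    have hv : ∀ b ∈ I, eval w b = 0 := fun b hb => by
      have := (mem_vanishingIdeal_singleton_iff w b).1 (hIM hb)
      rwa [aeval_eq_eval] at this
    have hw : eval w (W.affineCubic i) = 0 :=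
      hv _ ⟨0, by rw [W.affineEval_affineCubic, map_zero, zero_mul]⟩
    obtain ⟨a, b, hb, rfl⟩ := (W.mem_localRing_chartPoint_iff hw g).1 (hg w hw)
    exact absurd (hv b ⟨a, mul_div_cancel₀ _ (W.affineEval_ne_zero hw hb)⟩) hb

/-- Polynomials in the fibre coordinate of the `i`-th chart, with coefficients in the polynomials
in the base coordinate, as rational functions. -/
def polyEval (i : Fin 2) : Polynomial (Polynomial ℂ) →+* W.functionField :=
  Polynomial.eval₂RingHom (Polynomial.aeval (W.baseFn i)).toRingHom (W.fibreFn i)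

lemma polyEval_polyChart (i : Fin 2) (A : MvPolynomial (Fin 4) ℂ) :
    W.polyEval i (polyChart i A) = W.affineEval i (dehom i A) := by
  induction A using MvPolynomial.induction_on with
  | C a => simp [polyEval, polyChart, dehom]
  | add p q hp hq => simp only [map_add, hp, hq]
  | mul_X p j hp =>
    simp only [map_mul, hp]
    congr 1
    fin_cases i <;> fin_cases j <;>
      simp [polyEval, polyChart, dehom, affineEval, chartVec]

lemma polyEval_eq_sum (i : Fin 2) {Q : Polynomial (Polynomial ℂ)} (hQ : Q.degree < 3) :
    W.polyEval i Q =
      ∑ j : Fin 3, Polynomial.aeval (W.baseFn i) (Q.coeff j) * W.fibreFn i ^ (j : ℕ) := by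
  have h : Q.natDegree < 3 := by
    by_cases h0 : Q = 0
    · simp [h0]
    · exact (Polynomial.natDegree_lt_iff_degree_lt h0).2 hQ
  rw [polyEval, Polynomial.coe_eval₂RingHom, Polynomial.eval₂_eq_sum_range' _ h,
    Finset.sum_range]
  rfl

lemma exists_isBihom_polyChart_eq (e : ℕ) (i : Fin 2) (Q : Polynomial (Polynomial ℂ)) :
    ∃ (n : ℕ × ℕ) (A : MvPolynomial (Fin 4) ℂ), IsBihom e A n ∧ polyChart i A = Q := by
  have hf : ∀ A, polyChart i A =
      aeval ![(Polynomial.C Polynomial.X : Polynomial (Polynomial ℂ)), Polynomial.X]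
        (dehom i A) := fun A => by
    rw [aeval_dehom]; rfl
  have hs : ∃ P : MvPolynomial (Fin 2) ℂ,
      aeval ![(Polynomial.C Polynomial.X : Polynomial (Polynomial ℂ)), Polynomial.X] P = Q := by
    induction Q using Polynomial.induction_on' with
    | add p q hp hq =>
      obtain ⟨a, rfl⟩ := hp
      obtain ⟨b, rfl⟩ := hq
      exact ⟨a + b, map_add _ _ _⟩
    | monomial n a =>
      refine ⟨Polynomial.aeval (X 0) a * X 1 ^ n, ?_⟩
      rw [map_mul, map_pow, aeval_X, ← Polynomial.aeval_algHom_apply, aeval_X,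
        ← Polynomial.C_mul_X_pow_eq_monomial]
      congr 1
      have := Polynomial.aeval_algHom_apply
        (IsScalarTower.toAlgHom ℂ (Polynomial ℂ) (Polynomial (Polynomial ℂ))) Polynomial.X a
      simpa using this
  obtain ⟨P, rfl⟩ := hs
  obtain ⟨n, A, hA, rfl⟩ := exists_isBihom_dehom_eq e i P
  exact ⟨n, A, hA, hf A⟩

/-- `1, x, x²` are linearly independent over the polynomials in the base coordinate. -/
lemma eq_zero_of_polyEval_eq_zero (i : Fin 2) {Q : Polynomial (Polynomial ℂ)}
    (hQ : Q.degree < 3) (h : W.polyEval i Q = 0) : Q = 0 := by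
  obtain ⟨n, A, hA, rfl⟩ := exists_isBihom_polyChart_eq (2 * d) i Q
  rw [polyEval_polyChart, ← W.res_eq_zero_iff_affineEval i hA] at h
  exact W.polyChart_eq_zero_of_res_eq_zero i h hQ

/-- `1, x, x²` generate the regular functions on a chart over the polynomials in the base
coordinate. -/
lemma exists_polyEval_eq_affineEval (i : Fin 2) (P : MvPolynomial (Fin 2) ℂ) :
    ∃ Q : Polynomial (Polynomial ℂ), Q.degree < 3 ∧ W.affineEval i P = W.polyEval i Q := by
  obtain ⟨A, rfl⟩ := dehom_surjective i P
  refine ⟨polyChart i A %ₘ polyChart i W.cubic, ?_, ?_⟩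
  · rw [← W.degree_polyChart_cubic i]
    exact Polynomial.degree_modByMonic_lt _ (W.monic_polyChart_cubic i)
  · have h0 : W.polyEval i (polyChart i W.cubic) = 0 := by
      rw [polyEval_polyChart]; exact W.affineEval_affineCubic i
    rw [← polyEval_polyChart]
    conv_lhs => rw [← Polynomial.modByMonic_add_div (polyChart i A) (polyChart i W.cubic)]
    rw [map_add, map_mul, h0, zero_mul, add_zero]

/-- The first base coordinate divided by the base coordinate that is nonzero on the `i`-th chart. -/
def transition (i : Fin 2) : W.functionField :=
  W.ratio (X 0) (X (baseIdx i)) (1, 0) (isBihom_X0 _) (isBihom_X_baseIdx _ i)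

lemma transition_zero : W.transition 0 = 1 :=
  Subtype.ext (div_self (W.res_X_baseIdx_ne_zero 0))

lemma baseFn_mul : W.baseFn 0 * W.baseFn 1 = 1 := by
  have h0 := W.res_X_baseIdx_ne_zero 0
  have h1 := W.res_X_baseIdx_ne_zero 1
  apply Subtype.ext
  change W.res (X 1) / W.res (X 0) * (W.res (X 0) / W.res (X 1)) = 1
  change W.res (X 0) ≠ 0 at h0
  change W.res (X 1) ≠ 0 at h1
  field_simp

lemma fibreFn_one : W.fibreFn 1 = W.fibreFn 0 * W.baseFn 1 ^ (2 * d) := by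
  have h0 : W.res (X 0) ≠ 0 := W.res_X_baseIdx_ne_zero 0
  have h1 : W.res (X 1) ≠ 0 := W.res_X_baseIdx_ne_zero 1
  have h3 := W.res_X3_ne_zero
  apply Subtype.ext
  change W.res (X 2) / W.res (X 1 ^ (2 * d) * X 3) =
    W.res (X 2) / W.res (X 0 ^ (2 * d) * X 3) * (W.res (X 0) / W.res (X 1)) ^ (2 * d)
  rw [map_mul, map_mul, map_pow, map_pow, div_pow]
  field_simp

/-- The sections over `𝒞` of the `k`-th multiple of a fibre, trivialized by the `k`-th power of the
first base coordinate. -/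
def fibreSections (k : ℕ) : Submodule ℂ W.functionField where
  carrier := {g | ∀ p ∈ W.branchCurve, g * W.transition (chartIdx p) ^ k ∈ W.localRing p}
  add_mem' := fun hf hg p hp => by rw [add_mul]; exact add_mem (hf p hp) (hg p hp)
  zero_mem' := fun p _ => by rw [zero_mul]; exact zero_mem _
  smul_mem' := fun a f hf p hp => by
    rw [smul_mul_assoc]; exact Subalgebra.smul_mem _ (hf p hp) a

/-- Multiplied by `sᵏ` with `k = n + 2dj + m`, the monomial becomes `tⁿ xʲ sᵐ / zʲ`, and `z` has no
zero on `𝒞`. -/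
lemma monomial_mem_fibreSections {k n j : ℕ} (h : n + 2 * d * j ≤ k) :
    W.baseFn 0 ^ n * W.fibreFn 0 ^ j ∈ W.fibreSections k := by
  intro p hp
  obtain ⟨m, rfl⟩ := Nat.exists_eq_add_of_le h
  have h0 : W.res (X 0) ≠ 0 := W.res_X_baseIdx_ne_zero 0
  have hi := W.res_X_baseIdx_ne_zero (chartIdx p)
  have h3 := W.res_X3_ne_zero
  refine ⟨(n + 2 * d * j + m, j), X 1 ^ n * X 2 ^ j * X 0 ^ m,
    X (baseIdx (chartIdx p)) ^ (n + 2 * d * j + m) * X 3 ^ j, ?_, ?_, ?_, ?_, ?_⟩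
  · convert (((isBihom_X1 (2 * d)).pow n).mul ((isBihom_X2 (2 * d)).pow j)).mul
      ((isBihom_X0 (2 * d)).pow m) using 1
    exact Prod.ext (by simp; ring) (by simp)
  · convert ((isBihom_X_baseIdx (2 * d) (chartIdx p)).pow (n + 2 * d * j + m)).mul
      ((isBihom_X3 (2 * d)).pow j) using 1
    exact Prod.ext (by simp) (by simp)
  · rw [map_mul, map_pow, map_pow]
    exact mul_ne_zero (pow_ne_zero _ hi) (pow_ne_zero _ h3)
  · rintro ⟨v, rfl, hv⟩
    rw [map_mul, map_pow, map_pow, eval_X, eval_X] at hv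
    rcases mul_eq_zero.1 hv with hv | hv
    · refine notMem_zeroLocus_denom (Ruled.mk (2 * d) v) ⟨v, rfl, ?_⟩
      rw [denom_eq, eval_X]
      exact eq_zero_of_pow_eq_zero hv
    · refine hp.2 ((mk_mem_sectionAtInfinity _ v).2 ?_)
      exact eq_zero_of_pow_eq_zero hv
  · change (W.res (X 1) / W.res (X 0)) ^ n * (W.res (X 2) / W.res (X 0 ^ (2 * d) * X 3)) ^ j *
      (W.res (X 0) / W.res (X (baseIdx (chartIdx p)))) ^ (n + 2 * d * j + m) = _
    simp only [map_mul, map_pow, div_pow, mul_pow, ← pow_mul]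
    rw [pow_add (W.res (X 0)), pow_add (W.res (X 0))]
    field_simp

lemma exists_polyEval_zero_of_mem {k : ℕ} {g : W.functionField} (hg : g ∈ W.fibreSections k) :
    ∃ Q : Polynomial (Polynomial ℂ), Q.degree < 3 ∧ g = W.polyEval 0 Q := by
  obtain ⟨P, hP⟩ := W.exists_eq_affineEval_of_regular 0 g fun w hw => by
    have h := hg _ ((W.chartPoint_mem_branchCurve 0 w).2 hw)
    have hi : chartIdx (chartPoint d 0 w) = 0 := by
      rw [chartIdx, if_neg]
      rw [chartPoint, mk_mem_zeroLocus_iff (isBihom_X0 _)]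
      simp [chartCoord, chartVec]
    rwa [hi, transition_zero, one_pow, mul_one] at h
  obtain ⟨Q, hQ, h⟩ := W.exists_polyEval_eq_affineEval 0 P
  exact ⟨Q, hQ, hP.trans h⟩

lemma exists_polyEval_one_of_mem {k : ℕ} {g : W.functionField} (hg : g ∈ W.fibreSections k) :
    ∃ Q : Polynomial (Polynomial ℂ), Q.degree < 3 ∧
      g * W.baseFn 1 ^ k = W.polyEval 1 Q := by
  obtain ⟨P, hP⟩ := W.exists_eq_affineEval_of_regular 1 (g * W.baseFn 1 ^ k) fun w hw => by
    have h := hg _ ((W.chartPoint_mem_branchCurve 1 w).2 hw)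
    generalize chartIdx (chartPoint d 1 w) = i at h
    -- A point of the second chart with `s ≠ 0` has chart index 0. There `g` itself is regular, and
    -- so is its product with powers of `baseFn 1`.
    fin_cases i
    · simp only [Fin.zero_eta] at h
      rw [transition_zero, one_pow, mul_one] at h
      refine mul_mem h (pow_mem ?_ k)
      rw [← affineEval_X0]
      exact SetLike.coe_mem (germ hw (X 0))
    · exact h
  obtain ⟨Q, hQ, h⟩ := W.exists_polyEval_eq_affineEval 1 P
  exact ⟨Q, hQ, hP.trans h⟩

/-- Comparison of the two charts bounds the degrees of the coefficients. -/
lemma natDegree_coeff_add_le_of_mem {k : ℕ} {g : W.functionField} (hg : g ∈ W.fibreSections k)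
    {Q : Polynomial (Polynomial ℂ)} (hQ : Q.degree < 3) (h : g = W.polyEval 0 Q) (j : Fin 3)
    (hj : Q.coeff j ≠ 0) : (Q.coeff j).natDegree + 2 * d * j ≤ k := by
  obtain ⟨Q', hQ', h'⟩ := W.exists_polyEval_one_of_mem hg
  -- With `u = baseFn 0` and `v = baseFn 1 = u⁻¹`, the factor `uᴺ` clears all powers of `v` in the
  -- expansion on the second chart.
  obtain ⟨N, hN⟩ : ∃ N, ∀ j : Fin 3, (Q'.coeff j).natDegree + 2 * d * j ≤ N :=
    ⟨∑ j : Fin 3, ((Q'.coeff j).natDegree + 2 * d * j), fun j =>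
      Finset.single_le_sum (f := fun j : Fin 3 => (Q'.coeff j).natDegree + 2 * d * j)
        (fun _ _ => Nat.zero_le _) (Finset.mem_univ j)⟩
  -- Reflection turns `u ^ (N - 2dj)` times a polynomial in `v` into a polynomial in `u`; the shift
  -- `2dj` comes from `fibreFn 1 = fibreFn 0 * v ^ (2d)`.
  let R : Fin 3 → Polynomial ℂ := fun j => (Q'.coeff j).reflect (N - 2 * d * j)
  have huv := W.baseFn_mul
  have hvu : W.baseFn 1 * W.baseFn 0 = 1 := by rw [mul_comm, huv]
  let inv : Invertible (W.baseFn 1) := ⟨W.baseFn 0, huv, hvu⟩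
  have hR : ∀ j : Fin 3, W.baseFn 0 ^ N * (Polynomial.aeval (W.baseFn 1) (Q'.coeff j) *
      W.baseFn 1 ^ (2 * d * (j : ℕ))) = Polynomial.aeval (W.baseFn 0) (R j) := by
    intro j
    have h1 := Polynomial.eval₂_reflect_mul_pow (algebraMap ℂ W.functionField) (W.baseFn 1)
      (N - 2 * d * j) (Q'.coeff j) (by have := hN j; omega)
    obtain ⟨M, hM⟩ : ∃ M, N = M + 2 * d * j := ⟨N - 2 * d * j, by have := hN j; omega⟩
    have hM' : N - 2 * d * j = M := by omega
    change Polynomial.aeval (W.baseFn 0) (R j) * _ = Polynomial.aeval (W.baseFn 1) _ at h1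
    rw [hM'] at h1
    rw [← h1, hM, pow_add]
    calc _ = Polynomial.aeval (W.baseFn 0) (R j) * (W.baseFn 0 * W.baseFn 1) ^ M *
          (W.baseFn 0 * W.baseFn 1) ^ (2 * d * (j : ℕ)) := by
          rw [mul_pow, mul_pow]; ring
      _ = _ := by rw [huv, one_pow, one_pow, mul_one, mul_one]
  -- The two expansions of `uᴺ g` in `1, x, x²` must agree coefficient by coefficient, that is, `uᴺ
  -- Qⱼ = uᵏ Rⱼ`.
  obtain ⟨S, hSd, hSc⟩ := exists_degree_lt_three_coeff_eq fun j : Fin 3 =>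
    Polynomial.X ^ N * Q.coeff j - Polynomial.X ^ k * R j
  have hS : W.polyEval 0 S = 0 := by
    rw [W.polyEval_eq_sum 0 hSd]
    simp only [hSc, map_sub, map_mul, map_pow, Polynomial.aeval_X, sub_mul,
      Finset.sum_sub_distrib, sub_eq_zero, mul_assoc, ← Finset.mul_sum]
    rw [← W.polyEval_eq_sum 0 hQ, ← h]
    have h2 : g = W.baseFn 0 ^ k * W.polyEval 1 Q' := by
      rw [← h', mul_left_comm, ← mul_pow, huv, one_pow, mul_one]
    rw [h2, W.polyEval_eq_sum 1 hQ', mul_left_comm]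
    congr 1
    rw [Finset.mul_sum]
    refine Finset.sum_congr rfl fun j _ => ?_
    rw [← hR j, fibreFn_one, mul_pow, ← pow_mul]
    ring
  have h0 := hSc j
  rw [W.eq_zero_of_polyEval_eq_zero 0 hSd hS, Polynomial.coeff_zero, eq_comm, sub_eq_zero] at h0
  have hRj : R j ≠ 0 := by
    intro hR0
    rw [hR0, mul_zero] at h0
    exact mul_ne_zero (pow_ne_zero _ Polynomial.X_ne_zero) hj h0
  -- Now `N + deg Qⱼ = k + deg Rⱼ`, and `deg Rⱼ ≤ N - 2dj`.
  have hdeg := congrArg Polynomial.natDegree h0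
  rw [Polynomial.natDegree_X_pow_mul _ hj, Polynomial.natDegree_X_pow_mul _ hRj] at hdeg
  have hle : (R j).natDegree ≤ max (N - 2 * d * j) (Q'.coeff j).natDegree :=
    Polynomial.natDegree_reflect_le
  have := hN j
  rw [max_eq_left (by omega)] at hle
  omega

/-- The function with given coefficients. -/
def ofCoeffs (k : ℕ) :
    ((j : Fin 3) → Polynomial.degreeLT ℂ (k + 1 - 2 * d * j)) →ₗ[ℂ] W.functionField :=
  ∑ j : Fin 3, LinearMap.mulRight ℂ (W.fibreFn 0 ^ (j : ℕ)) ∘ₗ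
    (Polynomial.aeval (W.baseFn 0)).toLinearMap ∘ₗ (Polynomial.degreeLT ℂ _).subtype ∘ₗ
      LinearMap.proj j

lemma ofCoeffs_apply (k : ℕ) (a : (j : Fin 3) → Polynomial.degreeLT ℂ (k + 1 - 2 * d * j)) :
    W.ofCoeffs k a = ∑ j : Fin 3, Polynomial.aeval (W.baseFn 0) (a j : Polynomial ℂ) *
      W.fibreFn 0 ^ (j : ℕ) := by
  simp [ofCoeffs]

lemma ofCoeffs_injective (k : ℕ) : Function.Injective (W.ofCoeffs k) := by
  rw [← LinearMap.ker_eq_bot, LinearMap.ker_eq_bot']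
  intro a ha
  obtain ⟨S, hSd, hSc⟩ := exists_degree_lt_three_coeff_eq fun j : Fin 3 => (a j : Polynomial ℂ)
  have hS : W.polyEval 0 S = 0 := by
    rw [W.polyEval_eq_sum 0 hSd]
    simp only [hSc]
    rw [← ofCoeffs_apply, ha]
  funext j
  apply Subtype.ext
  rw [← hSc j, W.eq_zero_of_polyEval_eq_zero 0 hSd hS]
  simp

/-- The splitting `O(k) ⊕ O(k-2d) ⊕ O(k-4d)` on global sections: monomials give one inclusion, the
degree bound from comparing charts gives the other. -/
lemma range_ofCoeffs (k : ℕ) : LinearMap.range (W.ofCoeffs k) = W.fibreSections k := by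
  apply le_antisymm
  · rintro _ ⟨a, rfl⟩
    rw [ofCoeffs_apply]
    refine Submodule.sum_mem _ fun j _ => ?_
    by_cases h0 : (a j : Polynomial ℂ) = 0
    · rw [h0, map_zero, zero_mul]; exact Submodule.zero_mem _
    · have hd := (Polynomial.natDegree_lt_iff_degree_lt h0).2 (Polynomial.mem_degreeLT.1 (a j).2)
      rw [Polynomial.aeval_eq_sum_range, Finset.sum_mul]
      refine Submodule.sum_mem _ fun n hn => ?_
      rw [smul_mul_assoc]
      refine Submodule.smul_mem _ _ (W.monomial_mem_fibreSections ?_)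
      have := Finset.mem_range.1 hn
      omega
  · intro g hg
    obtain ⟨Q, hQ, h⟩ := W.exists_polyEval_zero_of_mem hg
    refine ⟨fun j => ⟨Q.coeff j, Polynomial.mem_degreeLT.2 ?_⟩, ?_⟩
    · by_cases h0 : Q.coeff j = 0
      · rw [h0, Polynomial.degree_zero]; exact WithBot.bot_lt_coe _
      · rw [← Polynomial.natDegree_lt_iff_degree_lt h0]
        have := W.natDegree_coeff_add_le_of_mem hg hQ h j h0
        omega
    · rw [ofCoeffs_apply]
      exact (h.trans (W.polyEval_eq_sum 0 hQ)).symm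

/-- The dimension of the space of sections of a multiple of a fibre. -/
theorem finrank_fibreSections (k : ℕ) : Module.finrank ℂ (W.fibreSections k) =
    (k + 1) + (k + 1 - 2 * d) + (k + 1 - 4 * d) := by
  rw [← range_ofCoeffs, LinearMap.finrank_range_of_inj (W.ofCoeffs_injective k)]
  have hf : ∀ n, Module.finrank ℂ (Polynomial.degreeLT ℂ n) = n := fun n => by
    rw [(Polynomial.degreeLTEquiv ℂ n).finrank_eq]; simp
  have : ∀ n, Module.Finite ℂ (Polynomial.degreeLT ℂ n) := fun n =>
    Module.Finite.equiv (Polynomial.degreeLTEquiv ℂ n).symm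
  -- Truncated subtraction is meant here: the degree bound 0 leaves only the zero polynomial, just
  -- as negative line bundles on the projective line have no sections.
  rw [Module.finrank_pi_fintype, Fin.sum_univ_three, hf, hf, hf]
  simp
  omega

end WeierstrassModel

/-! ### Derivations of the function field, via dual numbers -/

namespace WeierstrassModel

section Dual

variable {σ E : Type*} [Field E] [Algebra ℂ E]

/-- The homomorphism to the dual numbers that corresponds to the derivation with values `c`. -/
def polyDual (φ : MvPolynomial σ ℂ →ₐ[ℂ] E) (c : σ → E) : MvPolynomial σ ℂ →ₐ[ℂ] DualNumber E :=
  aeval fun j => TrivSqZeroExt.inl (φ (X j)) + TrivSqZeroExt.inr (c j)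

lemma fst_polyDual (φ : MvPolynomial σ ℂ →ₐ[ℂ] E) (c : σ → E) (A : MvPolynomial σ ℂ) :
    (polyDual φ c A).fst = φ A := by
  have : (TrivSqZeroExt.fstHom ℂ E E).comp (polyDual φ c) = φ := by
    ext j
    simp [polyDual]
  exact DFunLike.congr_fun this A

lemma snd_polyDual [Fintype σ] (φ : MvPolynomial σ ℂ →ₐ[ℂ] E) (c : σ → E)
    (A : MvPolynomial σ ℂ) : (polyDual φ c A).snd = ∑ j, φ (pderiv j A) * c j := by
  classical
  induction A using MvPolynomial.induction_on with
  | C a => simp [polyDual, TrivSqZeroExt.algebraMap_eq_inl']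
  | add p q hp hq =>
    rw [map_add, TrivSqZeroExt.snd_add, hp, hq, ← Finset.sum_add_distrib]
    simp only [map_add, add_mul]
  | mul_X p k hp =>
    rw [map_mul, TrivSqZeroExt.snd_mul, hp, fst_polyDual, fst_polyDual]
    have hX : (polyDual φ c (X k)).snd = c k := by simp [polyDual]
    rw [hX]
    simp only [Derivation.leibniz, smul_eq_mul, map_add, map_mul, MulOpposite.smul_eq_mul_unop,
      MulOpposite.unop_op, pderiv_X, add_mul, Finset.sum_add_distrib]
    congr 1
    · rw [Finset.sum_eq_single k]
      · simp
      · intro j _ hj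
        simp [hj]
      · simp
    · rw [mul_comm, Finset.mul_sum]
      exact Finset.sum_congr rfl fun j _ => by ring

/-- Vector fields that are tangent to a subvariety are derivations of its function field. -/
theorem exists_derivation_of_tangent [Fintype σ] {G : MvPolynomial σ ℂ}
    [Algebra (MvPolynomial σ ℂ ⧸ Ideal.span {G}) E]
    [IsScalarTower ℂ (MvPolynomial σ ℂ ⧸ Ideal.span {G}) E]
    [IsFractionRing (MvPolynomial σ ℂ ⧸ Ideal.span {G}) E] (φ : MvPolynomial σ ℂ →ₐ[ℂ] E)
    (hφ : ∀ A, φ A = algebraMap (MvPolynomial σ ℂ ⧸ Ideal.span {G}) E (Ideal.Quotient.mk _ A))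
    (c : σ → E) (hc : ∑ j, φ (pderiv j G) * c j = 0) :
    ∃ δ : Derivation ℂ E E, ∀ j, δ (φ (X j)) = c j := by
  -- Tangency says exactly that the homomorphism to the dual numbers kills `G`. It descends to the
  -- quotient, and extends to the fraction field because a dual number is a unit as soon as its
  -- first component is.
  have hG : polyDual φ c G = 0 := by
    refine TrivSqZeroExt.ext ?_ ?_
    · rw [fst_polyDual, hφ, Ideal.Quotient.eq_zero_iff_mem.2 (Ideal.mem_span_singleton_self G),
        map_zero, TrivSqZeroExt.fst_zero]
    · rw [snd_polyDual, hc, TrivSqZeroExt.snd_zero]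
  let Φ : MvPolynomial σ ℂ ⧸ Ideal.span {G} →ₐ[ℂ] DualNumber E :=
    Ideal.Quotient.liftₐ _ (polyDual φ c) fun a ha => by
      obtain ⟨b, rfl⟩ := Ideal.mem_span_singleton.1 ha
      rw [map_mul, hG, zero_mul]
  have hΦ : ∀ A, Φ (Ideal.Quotient.mk _ A) = polyDual φ c A := fun A => rfl
  have hfst : ∀ a, (Φ a).fst = algebraMap _ E a := fun a => by
    obtain ⟨A, rfl⟩ := Ideal.Quotient.mk_surjective a
    rw [hΦ, fst_polyDual, hφ]
  let Ψ : E →ₐ[ℂ] DualNumber E := IsLocalization.liftAlgHom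
    (M := nonZeroDivisors (MvPolynomial σ ℂ ⧸ Ideal.span {G})) (f := Φ) fun y => by
      rw [TrivSqZeroExt.isUnit_iff_isUnit_fst, hfst]
      exact IsLocalization.map_units _ y
  have hΨ : ∀ A, Ψ (φ A) = polyDual φ c A := fun A => by
    rw [hφ, IsLocalization.liftAlgHom_apply, IsLocalization.lift_eq]
    rfl
  -- As `Ψ` is a section of the first projection, its second component is a derivation.
  have hΨfst : ∀ f, (Ψ f).fst = f := by
    have : ((TrivSqZeroExt.fstHom ℂ E E).comp Ψ).toRingHom = RingHom.id E := by
      refine IsLocalization.ringHom_ext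
        (nonZeroDivisors (MvPolynomial σ ℂ ⧸ Ideal.span {G})) (RingHom.ext fun a => ?_)
      obtain ⟨A, rfl⟩ := Ideal.Quotient.mk_surjective a
      rw [RingHom.comp_apply, RingHom.comp_apply, ← hφ]
      change (Ψ (φ A)).fst = φ A
      rw [hΨ, fst_polyDual]
    exact fun f => DFunLike.congr_fun this f
  refine ⟨Derivation.mk' ((TrivSqZeroExt.sndHom E E).restrictScalars ℂ ∘ₗ Ψ.toLinearMap)
    fun a b => ?_, fun j => ?_⟩
  · change (Ψ (a * b)).snd = a • (Ψ b).snd + b • (Ψ a).snd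
    rw [map_mul, TrivSqZeroExt.snd_mul, hΨfst, hΨfst]
    simp [mul_comm]
  · change (Ψ (φ (X j))).snd = c j
    rw [hΨ]
    simp [polyDual]

end Dual

section LinearAlgebra

variable {K V : Type*} [Field K] [AddCommGroup V] [Module K V]

/-- Used with `U = du`, `Z = dx` and the relation `0 = dG`: eliminating `dx` expresses every
differential through `du / ∂ₓG`. -/
lemma smul_add_smul_eq_of_relation {x y : K} {U Z : V} (hy : y ≠ 0) (h : 0 = x • U + y • Z)
    (a b : K) : a • U + b • Z = (a * y - b * x) • (y⁻¹ • U) := by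
  have hZ : Z = -(y⁻¹ * x) • U := by
    rw [neg_smul, mul_smul, ← smul_neg, eq_inv_smul_iff₀ hy]
    exact (neg_eq_of_add_eq_zero_right h.symm).symm
  rw [hZ, smul_smul, smul_smul, ← add_smul]
  congr 1
  field_simp
  ring

/-- Used with `U = du` and `Z = dv` for `u v = 1`, so that `dv = -v² du`. The exponent shift by 2 is
the degree `-2` of the canonical class of the projective line. -/
lemma inv_smul_eq_of_relation {u v e : K} {U Z : V} (huv : u * v = 1) (h : 0 = u • Z + v • U)
    (he : e ≠ 0) (n : ℕ) : e⁻¹ • U = (-1 * v ^ n) • ((v ^ (n + 2) * e)⁻¹ • Z) := by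
  have hv : v ≠ 0 := right_ne_zero_of_mul_eq_one huv
  have hZ : Z = -(v * v) • U := by
    have h' := congrArg (fun ω => v • ω) h
    simp only [smul_zero, smul_add, smul_smul] at h'
    rw [mul_comm v, huv, one_smul] at h'
    rw [neg_smul]
    exact eq_neg_of_add_eq_zero_left h'.symm
  rw [hZ, smul_smul, smul_smul]
  congr 1
  field_simp
  ring

variable {k : Type*} [CommRing k] [Algebra k K] [Module k V] (R : Subalgebra k K)
  (D : Derivation k K V) {ρ : V}

/-- The quotient rule, with the coefficient kept inside `R`. -/
lemma derivation_eq_smul_of_mul_unit (r : R) (u : Rˣ) {a b : R}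
    (ha : D (r * (u : R) : K) = (a : K) • ρ) (hb : D ((u : R) : K) = (b : K) • ρ) :
    D (r : K) = ((↑u⁻¹ * (a - r * b) : R) : K) • ρ := by
  have hu : ((↑u⁻¹ : R) : K) * ((u : R) : K) = 1 := by
    rw [← MulMemClass.coe_mul, Units.inv_mul, OneMemClass.coe_one]
  rw [Derivation.leibniz, hb, ← eq_sub_iff_add_eq', smul_smul, ← sub_smul] at ha
  rw [MulMemClass.coe_mul, mul_smul, AddSubgroupClass.coe_sub, MulMemClass.coe_mul, ← ha,
    smul_smul, hu, one_smul]

lemma derivation_mul_eq_smul (r s : R) {a b : R} (ha : D (r : K) = (a : K) • ρ)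
    (hb : D (s : K) = (b : K) • ρ) :
    D ((r * s : R) : K) = ((r * b + s * a : R) : K) • ρ := by
  rw [MulMemClass.coe_mul, Derivation.leibniz, ha, hb, smul_smul, smul_smul, ← add_smul]
  rfl

end LinearAlgebra

/-! ### Differential forms and the residue form -/

variable {d : ℕ} (W : WeierstrassModel d) [W.IsIrreducible]

/-- The function field has a derivation that does not vanish on the base coordinate. -/
lemma exists_derivation_baseFn_ne_zero :
    ∃ δ : Derivation ℂ W.functionField (FractionRing W.CoordRing), δ (W.baseFn 0) ≠ 0 := by
  obtain ⟨δ, hδ⟩ := exists_derivation_of_tangent W.res (fun _ => rfl)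
    -- The vector field `∂ₓG ∂ₜ - ∂ₜG ∂ₓ`, with `G` the homogeneous cubic, is tangent to `G = 0`. It
    -- kills `s` and sends `t` to `∂ₓG`, which is nonzero on `𝒞`.
    ![0, W.res (pderiv 2 W.cubic), -W.res (pderiv 1 W.cubic), 0] (by
      simp only [Fin.sum_univ_four, Matrix.cons_val]
      ring)
  let δ' : Derivation ℂ W.functionField (FractionRing W.CoordRing) :=
    Derivation.mk' (δ.toLinearMap ∘ₗ W.functionField.val.toLinearMap)
      fun a b => δ.leibniz (a : FractionRing W.CoordRing) b
  refine ⟨δ', fun h => ?_⟩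
  have h0 : W.res (X 0) ≠ 0 := W.res_X_baseIdx_ne_zero 0
  have hx : W.res (X 0) * (W.baseFn 0 : FractionRing W.CoordRing) = W.res (X 1) :=
    mul_div_cancel₀ _ h0
  have h1 := congrArg δ hx
  have h2 : δ (W.baseFn 0 : FractionRing W.CoordRing) = 0 := h
  rw [Derivation.leibniz, h2, hδ, hδ, smul_zero, zero_add] at h1
  simp only [Matrix.cons_val, smul_zero] at h1
  exact W.res_pderiv_cubic_ne_zero h1.symm

open KaehlerDifferential in
lemma D_baseFn_ne_zero : D ℂ W.functionField (W.baseFn 0) ≠ 0 := fun h => by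
  obtain ⟨δ, hδ⟩ := W.exists_derivation_baseFn_ne_zero
  have := δ.liftKaehlerDifferential_comp_D (W.baseFn 0)
  rw [h, map_zero] at this
  exact hδ this.symm

open KaehlerDifferential

lemma D_affineEval (i : Fin 2) (a : MvPolynomial (Fin 2) ℂ) :
    D ℂ W.functionField (W.affineEval i a) =
      W.affineEval i (pderiv 0 a) • D ℂ W.functionField (W.baseFn i) +
        W.affineEval i (pderiv 1 a) • D ℂ W.functionField (W.fibreFn i) := by
  induction a using MvPolynomial.induction_on with
  | C r =>
    have : W.affineEval i (C r) = algebraMap ℂ _ r := by simp [affineEval]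
    rw [this, Derivation.map_algebraMap]
    simp
  | add p q hp hq =>
    simp only [map_add, hp, hq, add_smul]
    abel
  | mul_X p j hp =>
    rw [map_mul, Derivation.leibniz, hp]
    fin_cases j
    · simp only [Fin.zero_eta, affineEval_X0, Derivation.leibniz, pderiv_X_self, smul_eq_mul,
        mul_one, map_add, map_mul, pderiv_X_of_ne (show (0 : Fin 2) ≠ 1 by decide), mul_zero,
        zero_add, add_smul, smul_add, smul_smul]
      abel
    · simp only [Fin.mk_one, affineEval_X1, Derivation.leibniz, pderiv_X_self, smul_eq_mul,
        mul_one, map_add, map_mul, pderiv_X_of_ne (show (1 : Fin 2) ≠ 0 by decide), mul_zero,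
        zero_add, add_smul, smul_add, smul_smul]
      abel

/-- The residue form `du / ∂ₓG` on the `i`-th chart. -/
def residueForm (i : Fin 2) : Ω[W.functionField⁄ℂ] :=
  (W.affineEval i (pderiv 1 (W.affineCubic i)))⁻¹ • D ℂ W.functionField (W.baseFn i)

lemma residueForm_zero_ne_zero : W.residueForm 0 ≠ 0 :=
  smul_ne_zero (inv_ne_zero (W.affineEval_pderiv_ne_zero 0)) W.D_baseFn_ne_zero

lemma D_affineEval_eq_smul_residueForm (i : Fin 2) (a : MvPolynomial (Fin 2) ℂ) :
    D ℂ W.functionField (W.affineEval i a) = W.affineEval i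
      (pderiv 0 a * pderiv 1 (W.affineCubic i) - pderiv 1 a * pderiv 0 (W.affineCubic i)) •
        W.residueForm i := by
  have h := W.D_affineEval i (W.affineCubic i)
  rw [affineEval_affineCubic, map_zero] at h
  rw [D_affineEval, map_sub, map_mul, map_mul]
  exact smul_add_smul_eq_of_relation (W.affineEval_pderiv_ne_zero i) h _ _

/-- Differentials of polynomials are multiples of the residue form, and the quotient rule extends
this to all functions: the space of differentials is a line. -/
lemma exists_eq_smul_residueForm (i : Fin 2) (ω : Ω[W.functionField⁄ℂ]) :
    ∃ g : W.functionField, ω = g • W.residueForm i := by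
  have h : ω ∈ Submodule.span W.functionField {W.residueForm i} := by
    have : Submodule.span W.functionField (Set.range (D ℂ W.functionField)) ≤
        Submodule.span W.functionField {W.residueForm i} := by
      rw [Submodule.span_le]
      rintro _ ⟨f, rfl⟩
      obtain ⟨a, b, hb, rfl⟩ := W.exists_eq_affineEval_div i f
      have hD := (D ℂ W.functionField).leibniz (W.affineEval i a / W.affineEval i b)
        (W.affineEval i b)
      rw [div_mul_cancel₀ _ hb, D_affineEval_eq_smul_residueForm,
        D_affineEval_eq_smul_residueForm, ← sub_eq_iff_eq_add', smul_smul, ← sub_smul] at hD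
      have hmem : W.affineEval i b • D ℂ W.functionField (W.affineEval i a / W.affineEval i b) ∈
          Submodule.span W.functionField {W.residueForm i} := by
        rw [← hD]
        exact Submodule.smul_mem _ _ (Submodule.mem_span_singleton_self _)
      exact (Submodule.smul_mem_iff _ hb).1 hmem
    exact this (by rw [span_range_derivation]; trivial)
  obtain ⟨g, hg⟩ := Submodule.mem_span_singleton.1 h
  exact ⟨g, hg.symm⟩

variable {W}

section
variable {i : Fin 2} {w : Fin 2 → ℂ}

lemma D_localRing (hw : eval w (W.affineCubic i) = 0)
    (r : W.localRing (chartPoint d i w)) : ∃ s : W.localRing (chartPoint d i w),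
      D ℂ W.functionField r = (s : W.functionField) • W.residueForm i := by
  obtain ⟨a, b, hb, hab⟩ := exists_mul_germ_eq hw r
  obtain ⟨u, hu⟩ := hb
  have h1 : D ℂ W.functionField ((r : W.functionField) * (u : W.localRing (chartPoint d i w))) =
      (germ hw (pderiv 0 a * pderiv 1 (W.affineCubic i) -
        pderiv 1 a * pderiv 0 (W.affineCubic i)) : W.functionField) • W.residueForm i := by
    rw [hu, ← MulMemClass.coe_mul, hab]
    exact W.D_affineEval_eq_smul_residueForm i a
  have h2 : D ℂ W.functionField ((u : W.localRing (chartPoint d i w)) : W.functionField) =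
      (germ hw (pderiv 0 b * pderiv 1 (W.affineCubic i) -
        pderiv 1 b * pderiv 0 (W.affineCubic i)) : W.functionField) • W.residueForm i := by
    rw [hu]
    exact W.D_affineEval_eq_smul_residueForm i b
  exact ⟨_, derivation_eq_smul_of_mul_unit _ _ r u h1 h2⟩

/-- The residue form generates the regular differentials at each point of the chart. -/
lemma IsSmooth.D_uniformizer_chartPoint (hW : W.IsSmooth)
    (hw : eval w (W.affineCubic i) = 0) {π : W.localRing (chartPoint d i w)}
    (hπ : W.IsUniformizer _ π) : ∃ v : (W.localRing (chartPoint d i w))ˣ,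
      D ℂ W.functionField π = ((v : W.localRing (chartPoint d i w)) : W.functionField) •
        W.residueForm i := by
  obtain ⟨π₀, hπ₀, v₀, hv₀⟩ : ∃ π₀, W.IsUniformizer (chartPoint d i w) π₀ ∧
      ∃ v : (W.localRing (chartPoint d i w))ˣ, D ℂ W.functionField π₀ =
        ((v : W.localRing (chartPoint d i w)) : W.functionField) • W.residueForm i := by
    rcases hW.eval_pderiv_affineCubic hw with h | h
    -- Here `x - x₀` is a parameter and `dx = -∂ᵤG · (du / ∂ₓG)` with `∂ᵤG` a unit, even if `∂ₓG`
    -- vanishes at the point.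
    · refine ⟨_, (isUniformizer_germ hw).2 h, ((isUnit_germ_iff hw _).2 h).neg.unit, ?_⟩
      rw [coe_germ, D_affineEval_eq_smul_residueForm]
      simp [pderiv_X, coe_germ]
    · refine ⟨_, (isUniformizer_germ hw).1 h, ((isUnit_germ_iff hw _).2 h).unit, ?_⟩
      rw [coe_germ, D_affineEval_eq_smul_residueForm]
      simp [pderiv_X, coe_germ]
  obtain ⟨u, rfl⟩ := hπ₀.exists_unit_mul_eq hπ
  obtain ⟨s, hs⟩ := D_localRing hw (u : W.localRing (chartPoint d i w))
  -- The coefficient of `d(u π₀)`: a unit plus a multiple of `π₀`, hence a unit.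
  have hu : IsUnit ((u : W.localRing (chartPoint d i w)) * v₀ + π₀ * s) := by
    by_contra hu
    have h1 := (dvd_add_left (dvd_mul_right π₀ s)).1 ((hπ₀ _).2 hu)
    exact (hπ₀ _).1 h1 (u.isUnit.mul v₀.isUnit)
  refine ⟨hu.unit, ?_⟩
  exact derivation_mul_eq_smul _ _ _ _ hs hv₀

end

lemma IsSmooth.D_uniformizer (hW : W.IsSmooth) {p : Surface (2 * d)} (hp : p ∈ W.branchCurve)
    {π : W.localRing p} (hπ : W.IsUniformizer p π) : ∃ v : (W.localRing p)ˣ,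
      D ℂ W.functionField π = ((v : W.localRing p) : W.functionField) •
        W.residueForm (chartIdx p) := by
  obtain ⟨w, hpw, hw⟩ := exists_eq_chartPoint hp
  generalize chartIdx p = i at hpw hw
  subst hpw
  exact hW.D_uniformizer_chartPoint hw hπ

variable (W)

/-- The `x`-derivative of the cubic has bidegree `(4d, 2)`, so its two dehomogenizations differ by
`(s/t) ^ (4d)`. -/
lemma affineEval_one_pderiv : W.affineEval 1 (pderiv 1 (W.affineCubic 1)) =
    W.baseFn 1 ^ (4 * d) * W.affineEval 0 (pderiv 1 (W.affineCubic 0)) := by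
  have h0 : W.res (X 0) ≠ 0 := W.res_X_baseIdx_ne_zero 0
  have h1 : W.res (X 1) ≠ 0 := W.res_X_baseIdx_ne_zero 1
  have h3 := W.res_X3_ne_zero
  have e0 := W.res_eq_affineEval 0 W.isBihom_pderiv_cubic
  have e1 := W.res_eq_affineEval 1 W.isBihom_pderiv_cubic
  rw [e0, ← pderiv_one_dehom, ← pderiv_one_dehom] at e1
  apply Subtype.ext
  change W.res (X 0) ^ (4 * d) * W.res (X 3) ^ 2 * _ =
    W.res (X 1) ^ (4 * d) * W.res (X 3) ^ 2 * _ at e1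
  change _ = (W.res (X 0) / W.res (X 1)) ^ (4 * d) * _
  rw [div_pow, affineCubic, affineCubic]
  field_simp
  refine mul_left_cancel₀ (pow_ne_zero 2 h3) ?_
  linear_combination -e1

/-- The residue forms on the two charts differ by a power of the transition function. -/
lemma residueForm_zero_eq (hd : 0 < d) (i : Fin 2) : ∃ ε : ℂˣ, W.residueForm 0 =
    (algebraMap ℂ W.functionField ε * W.transition i ^ (4 * d - 2)) • W.residueForm i := by
  fin_cases i
  · exact ⟨1, by simp [transition_zero]⟩
  · refine ⟨-1, ?_⟩
    have h := (D ℂ W.functionField).leibniz (W.baseFn 0) (W.baseFn 1)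
    rw [baseFn_mul, Derivation.map_one_eq_zero] at h
    -- Positivity of `d` makes the truncated `4d - 2` a true difference.
    have h4 : 4 * d = 4 * d - 2 + 2 := by omega
    have := inv_smul_eq_of_relation W.baseFn_mul h (W.affineEval_pderiv_ne_zero 0) (4 * d - 2)
    rw [← h4, ← affineEval_one_pderiv] at this
    rw [Units.val_neg, Units.val_one, map_neg, map_one]
    exact this

end WeierstrassModel

/-! ### Positivity of `d`, the genus and the theta characteristic -/

namespace WeierstrassModel

/-- A cubic with constant coefficients is reducible. -/
lemma pos_of_isIrreducible {d : ℕ} (W : WeierstrassModel d) [W.IsIrreducible] : 0 < d := by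
  rw [Nat.pos_iff_ne_zero]
  rintro rfl
  have key : ∀ {a : MvPolynomial (Fin 2) ℂ} {n : ℕ}, n = 0 → a.IsHomogeneous n →
      ∃ r, lift a = C r := by
    rintro a n rfl ha
    rw [← totalDegree_zero_iff_isHomogeneous, totalDegree_eq_zero_iff_eq_C] at ha
    exact ⟨_, by rw [ha, lift, rename_C]⟩
  obtain ⟨p, hp⟩ := key rfl W.hom₂
  obtain ⟨q, hq⟩ := key rfl W.hom₄
  obtain ⟨r, hr⟩ := key rfl W.hom₆
  let Q : Polynomial ℂ := Polynomial.X ^ 3 + (Polynomial.C p * Polynomial.X ^ 2 +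
    Polynomial.C q * Polynomial.X + Polynomial.C r)
  have hQ : Q.degree = 3 := by
    unfold Q
    compute_degree!
  -- A root of the constant cubic splits off a linear factor; both factors vanish at the origin, so
  -- neither is a unit.
  obtain ⟨x, hx⟩ := IsAlgClosed.exists_root Q (by rw [hQ]; decide)
  have hx' : x ^ 3 + (p * x ^ 2 + q * x + r) = 0 := by simpa [Q] using hx
  have hfac : W.cubic = (X 2 - C x * X 3) *
      (X 2 ^ 2 + C (p + x) * X 2 * X 3 + C (q + x * (p + x)) * X 3 ^ 2) := by
    have hC : (C x : MvPolynomial (Fin 4) ℂ) ^ 3 + (C p * C x ^ 2 + C q * C x + C r) = 0 := by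
      rw [← map_pow, ← map_pow, ← map_mul, ← map_mul, ← map_add, ← map_add, ← map_add, hx',
        map_zero]
    rw [cubic, hp, hq, hr]
    simp only [map_add, map_mul]
    linear_combination (X 3) ^ 3 * hC
  rcases (IsIrreducible.irreducible (W := W)).isUnit_or_isUnit hfac with h | h
  · have := h.map (eval (0 : Fin 4 → ℂ))
    simp at this
  · have := h.map (eval (0 : Fin 4 → ℂ))
    simp at this

lemma finrank_eq_of_mem_iff {k V V' : Type*} [Field k] [AddCommGroup V] [Module k V]
    [AddCommGroup V'] [Module k V'] (L : V →ₗ[k] V') (hL : Function.Bijective L)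
    {A : Submodule k V} {B : Submodule k V'} (h : ∀ x, x ∈ A ↔ L x ∈ B) :
    Module.finrank k A = Module.finrank k B := by
  have hA : A = B.comap (LinearEquiv.ofBijective L hL).toLinearMap := by
    ext x
    exact h x
  rw [hA]
  exact (LinearEquiv.ofSubmodule' (LinearEquiv.ofBijective L hL) B).finrank_eq

variable {d : ℕ} (W : WeierstrassModel d) [W.IsIrreducible]

/-- The equation of a fibre, divided by the first base coordinate. -/
def fibreFunction (c : Fin 2 → ℂ) : W.functionField :=
  W.ratio (fibreForm c) (X 0) (1, 0) (isBihom_fibreForm _ c) (isBihom_X0 _)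

/-- Separates the local equation into a global function and the transition function, which links
`fibreDivisor` to `fibreSections`. -/
lemma fibreEquation_eq (c : Fin 2 → ℂ) (p : Surface (2 * d)) :
    W.fibreEquation c p = W.fibreFunction c * W.transition (chartIdx p) := by
  have h0 : W.res (X 0) ≠ 0 := W.res_X_baseIdx_ne_zero 0
  apply Subtype.ext
  change W.res (fibreForm c) / W.res (denom p) =
    W.res (fibreForm c) / W.res (X 0) * (W.res (X 0) / W.res (X (baseIdx (chartIdx p))))
  rw [denom_eq, div_mul_div_cancel₀ h0]

lemma fibreFunction_ne_zero {c : Fin 2 → ℂ} (hc : c ≠ 0) :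
    W.fibreFunction c ≠ 0 := by
  have h := fibreEquation_ne_zero (W := W) hc (chartPoint d 0 0)
  rw [fibreEquation_eq] at h
  exact left_ne_zero_of_mul h

variable {W}

section Sections

variable {θ : W.Divisor} {c : Fin 2 → ℂ} {hc : c ≠ 0} {h : W.functionField} {k : ℕ}

lemma IsSmooth.hasOrd_of_linEquiv (hW : W.IsSmooth)
    (hθ : ∀ p : W.branchCurve, W.HasOrd p h (θ p - ((k : ℤ) • W.fibreDivisor c hc) p))
    (p : W.branchCurve) : W.HasOrd p (h * W.fibreEquation c p ^ k) (θ p) := by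
  have h1 := (hθ p).mul p.2 ((hW.hasOrd_fibreEquation hc p).zpow k)
  rw [Finsupp.smul_apply, smul_eq_mul, sub_add_cancel, zpow_natCast] at h1
  exact h1

/-- With `ℓ = fibreFunction c` and `τ` the transition function at `p`, a local equation of `θ` at
`p` is `h ℓᵏ τᵏ`. Multiplication by the global factor `h ℓᵏ` therefore carries `O(θ)` to the sheaf
of `kF`. -/
lemma IsSmooth.mem_H0_iff (hW : W.IsSmooth)
    (hθ : ∀ p : W.branchCurve, W.HasOrd p h (θ p - ((k : ℤ) • W.fibreDivisor c hc) p))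
    (f : W.functionField) : f ∈ W.H0 θ ↔ f * (h * W.fibreFunction c ^ k) ∈ W.fibreSections k := by
  have heq : ∀ p : Surface (2 * d), f * (h * W.fibreEquation c p ^ k) =
      f * (h * W.fibreFunction c ^ k) * W.transition (chartIdx p) ^ k := fun p => by
    rw [fibreEquation_eq, mul_pow]; ring
  constructor
  · intro hf p hp
    rw [← heq]
    exact hf ⟨p, hp⟩ _ (hW.hasOrd_of_linEquiv hθ ⟨p, hp⟩)
  · intro hf p g hg
    obtain ⟨u, rfl⟩ := hg.eq_unit_mul (hW.hasOrd_of_linEquiv hθ p)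
    rw [mul_left_comm, unit_mul_mem_localRing_iff, heq]
    exact hf p p.2

lemma IsSmooth.h0_eq (hW : W.IsSmooth) (h0 : h ≠ 0)
    (hθ : ∀ p : W.branchCurve, W.HasOrd p h (θ p - ((k : ℤ) • W.fibreDivisor c hc) p)) :
    W.h0 θ = (k + 1) + (k + 1 - 2 * d) + (k + 1 - 4 * d) := by
  have hm : h * W.fibreFunction c ^ k ≠ 0 :=
    mul_ne_zero h0 (pow_ne_zero _ (W.fibreFunction_ne_zero hc))
  rw [← W.finrank_fibreSections, WeierstrassModel.h0]
  exact finrank_eq_of_mem_iff (LinearMap.mulRight ℂ (h * W.fibreFunction c ^ k))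
    ⟨mul_left_injective₀ hm, fun y => ⟨y / _, div_mul_cancel₀ y hm⟩⟩ (hW.mem_H0_iff hθ)

end Sections

open KaehlerDifferential

/-- Adjunction in explicit form: the transition function is a local equation of the fibre `s = 0`,
so the residue form of the first chart has divisor `4d - 2` times that fibre. -/
lemma IsSmooth.residueForm_zero_eq_smul_D (hW : W.IsSmooth) {p : Surface (2 * d)}
    (hp : p ∈ W.branchCurve) {π : W.localRing p} (hπ : W.IsUniformizer p π) :
    ∃ y : (W.localRing p)ˣ, W.residueForm 0 = (((y : W.localRing p) : W.functionField) *
      W.transition (chartIdx p) ^ (4 * d - 2)) • D ℂ W.functionField π := by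
  obtain ⟨v, hv⟩ := hW.D_uniformizer hp hπ
  obtain ⟨ε, hε⟩ := W.residueForm_zero_eq W.pos_of_isIrreducible (chartIdx p)
  refine ⟨Units.map (algebraMap ℂ (W.localRing p)).toMonoidHom ε * v⁻¹, ?_⟩
  have hvv : (((v⁻¹ : (W.localRing p)ˣ) : W.localRing p) : W.functionField) *
      ((v : W.localRing p) : W.functionField) = 1 := by
    rw [← MulMemClass.coe_mul, Units.inv_mul, OneMemClass.coe_one]
  have hcoe : (((Units.map (algebraMap ℂ (W.localRing p)).toMonoidHom ε * v⁻¹ :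
      (W.localRing p)ˣ) : W.localRing p) : W.functionField) =
      algebraMap ℂ W.functionField ε * ((v⁻¹ : (W.localRing p)ˣ) : W.localRing p) := rfl
  rw [hcoe, hv, hε, smul_smul]
  congr 1
  rw [mul_assoc, mul_mul_mul_comm, hvv, mul_one]

lemma IsSmooth.smul_residueForm_mem_iff (hW : W.IsSmooth) (g : W.functionField) :
    g ∈ W.fibreSections (4 * d - 2) ↔ g • W.residueForm 0 ∈ W.regularForms := by
  constructor
  · intro hg p π hπ
    obtain ⟨y, hy⟩ := hW.residueForm_zero_eq_smul_D p.2 hπ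
    refine ⟨⟨_, (unit_mul_mem_localRing_iff y _).2 (hg p p.2)⟩, ?_⟩
    rw [hy, smul_smul, mul_left_comm]
  · intro hω p hp
    obtain ⟨π, hπ⟩ := hW.exists_uniformizer hp
    obtain ⟨y, hy⟩ := hW.residueForm_zero_eq_smul_D hp hπ
    obtain ⟨f, hf⟩ := hω ⟨p, hp⟩ π hπ
    have hD : D ℂ W.functionField π ≠ 0 := by
      intro h0
      rw [h0, smul_zero] at hy
      exact W.residueForm_zero_ne_zero hy
    rw [hy, smul_smul, mul_left_comm] at hf
    have hfg := smul_left_injective W.functionField hD hf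
    rw [← unit_mul_mem_localRing_iff y]
    exact hfg ▸ f.2

/-- The genus of `𝒞` is the dimension of the space of sections of `(4 d - 2) F`. -/
lemma IsSmooth.genus_eq (hW : W.IsSmooth) :
    W.genus = Module.finrank ℂ (W.fibreSections (4 * d - 2)) := by
  refine (finrank_eq_of_mem_iff ((LinearMap.toSpanSingleton W.functionField _
    (W.residueForm 0)).restrictScalars ℂ) ⟨?_, ?_⟩ hW.smul_residueForm_mem_iff).symm
  · exact smul_left_injective W.functionField W.residueForm_zero_ne_zero
  · intro ω
    obtain ⟨g, hg⟩ := W.exists_eq_smul_residueForm 0 ω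
    exact ⟨g, hg.symm⟩

/-- If `θ` is linearly equivalent to `(2 d - 1) F` then `2 θ` is a canonical divisor. -/
lemma IsSmooth.isCanonical_two_smul (hW : W.IsSmooth) {θ : W.Divisor} {c : Fin 2 → ℂ} {hc : c ≠ 0}
    {h : W.functionField} (h0 : h ≠ 0) {k : ℕ} (hk : 4 * d - 2 = k * 2)
    (hθ : ∀ p : W.branchCurve, W.HasOrd p h (θ p - ((k : ℤ) • W.fibreDivisor c hc) p)) :
    W.IsCanonical ((2 : ℤ) • θ) := by
  have hm : h * W.fibreFunction c ^ k ≠ 0 :=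
    mul_ne_zero h0 (pow_ne_zero _ (W.fibreFunction_ne_zero hc))
  -- The residue form contributes the power `2k` of the transition function, so near `p` this form
  -- is a unit times the square of a local equation of `θ`, times `dπ`.
  refine ⟨(h * W.fibreFunction c ^ k) ^ 2 • W.residueForm 0,
    smul_ne_zero (pow_ne_zero 2 hm) W.residueForm_zero_ne_zero, fun p => ?_⟩
  obtain ⟨π, hπ⟩ := hW.exists_uniformizer p.2
  obtain ⟨y, hy⟩ := hW.residueForm_zero_eq_smul_D p.2 hπ
  refine ⟨π, ((y : W.localRing p) : W.functionField) * (h * W.fibreEquation c p ^ k) ^ (2 : ℤ),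
    hπ, ?_, ?_⟩
  · rw [hy, smul_smul, hk]
    congr 1
    rw [fibreEquation_eq, mul_pow (W.fibreFunction c), pow_mul, ← mul_assoc h, zpow_ofNat,
      mul_pow _ _ 2]
    ring
  · have := (hW.hasOrd_unit p.2 y).mul p.2 ((hW.hasOrd_of_linEquiv hθ p).zpow 2)
    rwa [zero_add] at this

end WeierstrassModel

end

theorem lemma7p4 (d : ℕ) (W : WeierstrassModel d) [W.IsIrreducible] (hW : W.IsSmooth)
    (c : Fin 2 → ℂ) (hc : c ≠ 0) :
    (W.genus : ℤ) = 6 * d - 2 ∧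
    ∀ θ : W.Divisor, W.LinEquiv θ ((2 * d - 1 : ℤ) • W.fibreDivisor c hc) →
      W.IsThetaCharacteristic θ ∧ Even (W.h0 θ) ∧ W.h0 θ = 2 * d := by
  have hd := W.pos_of_isIrreducible
  refine ⟨?_, ?_⟩
  · rw [hW.genus_eq, W.finrank_fibreSections]
    omega
  · rintro θ ⟨h, h0, hθ⟩
    have hk : (2 * d - 1 : ℤ) = ((2 * d - 1 : ℕ) : ℤ) := by omega
    rw [hk] at hθ
    have hh : W.h0 θ = 2 * d := by
      -- With `k = 2d - 1` the second and third summands truncate to 0.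
      rw [hW.h0_eq h0 hθ]
      omega
    -- The divisor `2θ` is itself canonical, so the constant function 1 witnesses the linear
    -- equivalence.
    refine ⟨⟨(2 : ℤ) • θ, hW.isCanonical_two_smul h0 (by omega) hθ, 1, one_ne_zero, fun p => ?_⟩,
      hh ▸ even_two_mul d, hh⟩
    rw [sub_self]
    exact hW.hasOrd_unit p.2 1
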